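/- Consider a system of rigid bodies grouped into $N$ clusters that form a tree rooted at the ground, cluster $i$ having parent $p(i)<i$ and $n_i$ bodies; each body of a cluster is positioned relative to the ground (if the cluster has no parent) or relative to a fixed "parent body" in the parent cluster. (A tree of rigid bodies is the case $n_i=1$ for all $i$; local loop closures are treated by constraint embedding, with all bodies of a loop in one cluster.) Let $\overline{\mathcal Q}$ be the smooth configuration manifold, let the pose of each body be a smooth map $\overline{\mathcal Q}\to SE(3)$, and let generalized speeds $\overline v=(\overline{\mathtt v}_1,\dots,\overline{\mathtt v}_N)$ be taken along a smooth frame $(\overline X_a)$ of $\overline{\mathcal Q}$, so $\dot q=\sum_a\overline v^a\overline X_a$, where the speeds $\overline{\mathtt v}_i$ of joint $i$ move only the bodies of cluster $i$ relative to their parent bodies. For body $b$ with pose $T_b$ let $\mathbf v_b=(\omega_b,\boldsymbol v_b)\in\mathbb R^6$ be its body twist ($\mathbf v_b^\wedge=T_b^{-1}\dot T_b$), and $\mathbf I_b$ its spatial inertia in the body frame. Notation. $(\mathbf v\times)=\begin{bmatrix}\omega\times&0\\ \boldsymbol v\times&\omega\times\end{bmatrix}$, $(\mathbf v\times^\#)=-(\mathbf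 v\times)^\top$, and $(\mathbf f\,\overline\times^\#)$ is the matrix with $(\mathbf f\,\overline\times^\#)\mathbf v=(\mathbf v\times^\#)\mathbf f$ for all $\mathbf v$. $H=\mathrm{BlockDiag}(\mathbf I_b)$ and $(v\times)=\mathrm{BlockDiag}(\mathbf v_b\times)$ over all bodies; $v$ is the vector of all stacked body twists. $X$ is the block matrix whose block for bodies $(b,c)$ is the adjoint matrix ${\rm Ad}_{T_b^{-1}T_c}$ if $c$ lies on the path of parent bodies from $b$ to the ground ($c=b$ included), and $0$ otherwise. $\Phi=\mathrm{BlockDiag}(\Phi_1,\dots,\Phi_N)$, where the columns of $\Phi_i(q)$ are the stacked twists of the bodies of cluster $i$ relative to their parent bodies for unit speeds of joint $i$. $\dot\Phi=(v\times)\Phi+\mathring\Phi$, where $\mathring\Phi$ is the entrywise derivative of $\Phi$ along $\dot q$. $B=\mathrm{BlockDiag}(\mathbf B_b)$ with the Niemeyer--Slotine factors $\mathbf B_b=\tfrac12\left[(\mathbf v_b\times^\#)\mathbf I_b+(\mathbf I_b\mathbf v_b)\overline\times^\#-\mathbf I_b(\mathbf v_b\times)\right]$. Let $\langle\dot q,\dot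 q\rangle=\sum_b\mathbf v_b^\top\mathbf I_b\mathbf v_b$ be the kinetic-energy metric, $\overline H_{ij}=\langle\overline X_i,\overline X_j\rangle$, let the generalized Christoffel symbols be $$\overline\Gamma^\star_{ijk}=\tfrac12\left(\mathcal L_{\overline X_k}\overline H_{ij}+\mathcal L_{\overline X_j}\overline H_{ik}-\mathcal L_{\overline X_i}\overline H_{jk}+\langle\overline X_k,[\overline X_i,\overline X_j]\rangle+\langle\overline X_j,[\overline X_i,\overline X_k]\rangle+\langle\overline X_i,[\overline X_j,\overline X_k]\rangle\right),$$ and let $\overline C^\star_{ik}(q,\overline v)=\sum_j\overline\Gamma^\star_{ijk}(q)\,\overline v^j$ be the Christoffel-consistent Coriolis matrix. Then for all $q$ and $\overline v$: 1. $v=X\Phi\,\overline v$. 2. $\overline C^\star=\Phi^\top X^\top B\,X\,\Phi+\Phi^\top X^\top H\,X\,\dot\Phi$. 3. If $\nabla$ is a torsion-free affine connection on $\overline{\mathcal Q}$ compatible with the kinetic-energy metric, then $\overline C^\star_{ik}=\langle\overline X_i,\nabla_{\dot q}\overline X_k\rangle$. 4. The following algorithm, applied to the transforms ${}^iX_{p(i)}$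 (the blocks of $X$), $\Phi_i$, $\mathring\Phi_i$, the body inertias and $\overline v$, returns $\overline C^\star$. Forward, for $i=1,\dots,N$: $\mathsf v_i={}^iX_{p(i)}\mathsf v_{p(i)}+\Phi_i\overline{\mathtt v}_i$ (with the ground at rest), $\dot\Phi_i=(\mathsf v_i\times)\Phi_i+\mathring\Phi_i$, $\mathsf I_i^C=\mathsf I_i=\mathrm{BlockDiag}$ of the inertias of cluster $i$, $\mathsf B_i^C=\tfrac12[(\mathsf v_i\times^\#)\mathsf I_i+(\mathsf I_i\mathsf v_i)\overline\times^\#-\mathsf I_i(\mathsf v_i\times)]$. Backward, for $j=N,\dots,1$: put $\mathsf f_1=\mathsf I_j^C\dot\Phi_j+\mathsf B_j^C\Phi_j$, $\mathsf f_2=\mathsf I_j^C\Phi_j$, $\mathsf f_3=(\mathsf B_j^C)^\top\Phi_j$, $\overline C_{jj}=\Phi_j^\top\mathsf f_1$, $i=j$; while $i$ has a parent, replace each $\mathsf f_s$ by ${}^iX_{p(i)}^\top\mathsf f_s$, replace $i$ by $p(i)$, and put $\overline C_{ij}=\Phi_i^\top\mathsf f_1$, $\overline C_{ji}=(\dot\Phi_i^\top\mathsf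 f_2+\Phi_i^\top\mathsf f_3)^\top$; finally, if $j$ has a parent, add ${}^jX_{p(j)}^\top\mathsf I_j^C\,{}^jX_{p(j)}$ to $\mathsf I_{p(j)}^C$ and ${}^jX_{p(j)}^\top\mathsf B_j^C\,{}^jX_{p(j)}$ to $\mathsf B_{p(j)}^C$. All other blocks of $\overline C$ are zero. 5. The algorithm takes $\mathcal O(Nd)$ elementary operations, where $d$ is the depth of the tree (the largest number of clusters on a path to the ground), with a constant that depends only on upper bounds for the number of bodies and the number of generalized speeds per cluster. -/

import Mathlib

open scoped Matrix Manifold ContDiff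

noncomputable section

namespace Multibody

/-! ### Spatial vector algebra -/

/-- Index set of a spatial vector: the angular part (`inl`) followed by the linear part (`inr`). -/
abbrev Tw : Type := Fin 3 ⊕ Fin 3

/-- The cross-product matrix `(w ×)` of a vector `w ∈ ℝ³`. -/
def skew (w : Fin 3 → ℝ) : Matrix (Fin 3) (Fin 3) ℝ :=
  !![0, -w 2, w 1; w 2, 0, -w 0; -w 1, w 0, 0]

/-- The spatial cross-product matrix `(v ×)` of a twist `v = (ω, v)`, i.e. the little adjoint. -/
def crossMotion (v : Tw → ℝ) : Matrix Tw Tw ℝ :=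
  Matrix.fromBlocks (skew fun i => v (Sum.inl i)) 0
    (skew fun i => v (Sum.inr i)) (skew fun i => v (Sum.inl i))

/-- The matrix `(v ×#) = -(v ×)ᵀ`. -/
def crossForce (v : Tw → ℝ) : Matrix Tw Tw ℝ := -(crossMotion v)ᵀ

/-- The matrix `(f ×̄#)`, which is determined by `(f ×̄#) v = (v ×#) f` for all twists `v`:
its columns are the vectors `(e_c ×#) f`. -/
def crossForceBar (f : Tw → ℝ) : Matrix Tw Tw ℝ :=
  Matrix.of fun r c => (crossForce (Pi.single c 1) *ᵥ f) r

theorem crossForceBar_mulVec (f v : Tw → ℝ) :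
    crossForceBar f *ᵥ v = crossForce v *ᵥ f := by
  funext r
  rcases r with r | r <;> fin_cases r <;>
    simp [crossForceBar, crossForce, crossMotion, skew, Matrix.mulVec, dotProduct,
      Fin.sum_univ_three, Pi.single_apply] <;> ring

/-! ### Rigid-body poses -/

/-- An element of `SE(3)`: a rotation and the position of the origin of the moved frame. -/
structure Pose where
  rot : Matrix (Fin 3) (Fin 3) ℝ
  pos : Fin 3 → ℝ
  rot_mem : rot ∈ Matrix.specialOrthogonalGroup (Fin 3) ℝ

namespace Pose

/-- The homogeneous `4 × 4` matrix of a pose. -/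
def toMatrix (T : Pose) : Matrix (Fin 3 ⊕ Unit) (Fin 3 ⊕ Unit) ℝ :=
  Matrix.fromBlocks T.rot (Matrix.of fun i _ => T.pos i) 0 1

/-- Composition in `SE(3)`. -/
def mul (T S : Pose) : Pose where
  rot := T.rot * S.rot
  pos := T.rot *ᵥ S.pos + T.pos
  rot_mem := mul_mem T.rot_mem S.rot_mem

/-- Inversion in `SE(3)`. -/
def inv (T : Pose) : Pose where
  rot := T.rotᵀ
  pos := -(T.rotᵀ *ᵥ T.pos)
  rot_mem := by
    have h := T.rot_mem
    rw [Matrix.mem_specialOrthogonalGroup_iff, Matrix.mem_orthogonalGroup_iff] at h ⊢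
    refine ⟨?_, by rw [Matrix.det_transpose]; exact h.2⟩
    have h1 := mul_eq_one_comm.mp h.1
    simpa [Matrix.star_eq_conjTranspose] using h1

theorem toMatrix_mul (T S : Pose) : (T.mul S).toMatrix = T.toMatrix * S.toMatrix := by
  ext i j
  rcases i with i | i <;> rcases j with j | j <;>
    simp [toMatrix, mul, Matrix.mul_apply, Matrix.mulVec, dotProduct]

theorem toMatrix_inv_mul (T : Pose) : T.inv.toMatrix * T.toMatrix = 1 := by
  have h := T.rot_mem
  rw [Matrix.mem_specialOrthogonalGroup_iff, Matrix.mem_orthogonalGroup_iff] at h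
  have h1 : T.rotᵀ * T.rot = 1 := by
    have h2 := mul_eq_one_comm.mp h.1
    simpa [Matrix.star_eq_conjTranspose] using h2
  rw [← toMatrix_mul]
  simp [toMatrix, mul, inv, h1]
  rw [← Matrix.fromBlocks_one]
  congr 1

/-- The adjoint matrix of a pose, acting on twists. -/
def Ad (T : Pose) : Matrix Tw Tw ℝ :=
  Matrix.fromBlocks T.rot 0 (skew T.pos * T.rot) T.rot

end Pose

/-- The coordinates `(ω, v)` of a `4 × 4` matrix `[(ω ×), v; 0, 0]` of `se(3)`. -/
def vee (M : Matrix (Fin 3 ⊕ Unit) (Fin 3 ⊕ Unit) ℝ) : Tw → ℝ :=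
  Sum.elim
    ![M (Sum.inl 2) (Sum.inl 1), M (Sum.inl 0) (Sum.inl 2), M (Sum.inl 1) (Sum.inl 0)]
    (fun i => M (Sum.inl i) (Sum.inr ()))

/-- The inertial parameters of a rigid body: its mass, its centre of mass in the body frame, and
its rotational inertia about the origin of the body frame. -/
structure RigidBody where
  mass : ℝ
  com : Fin 3 → ℝ
  rotInertia : Matrix (Fin 3) (Fin 3) ℝ
  rotInertia_symm : rotInertia.IsSymm

/-- The spatial inertia of a rigid body in its body frame. -/
def RigidBody.inertia (b : RigidBody) : Matrix Tw Tw ℝ :=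
  Matrix.fromBlocks b.rotInertia (skew (b.mass • b.com))
    (skew (b.mass • b.com))ᵀ (b.mass • 1)

/-! ### Clusters of bodies

A cluster of `n` bodies has stacked twists indexed by `Tw × Fin n`. -/

section Cluster

variable {n : ℕ}

/-- `(v ×) = BlockDiag((v₁ ×), …, (vₙ ×))`. -/
def clusterCross (v : Tw × Fin n → ℝ) : Matrix (Tw × Fin n) (Tw × Fin n) ℝ :=
  Matrix.blockDiagonal fun b => crossMotion fun r => v (r, b)

/-- `(v ×#) = BlockDiag((v₁ ×#), …, (vₙ ×#))`. -/
def clusterCrossForce (v : Tw × Fin n → ℝ) : Matrix (Tw × Fin n) (Tw × Fin n) ℝ :=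
  Matrix.blockDiagonal fun b => crossForce fun r => v (r, b)

/-- `(f ×̄#) = BlockDiag((f₁ ×̄#), …, (fₙ ×̄#))`. -/
def clusterCrossForceBar (f : Tw × Fin n → ℝ) : Matrix (Tw × Fin n) (Tw × Fin n) ℝ :=
  Matrix.blockDiagonal fun b => crossForceBar fun r => f (r, b)

end Cluster

/-- The Niemeyer–Slotine factor `½ [(v ×#) I + (I v) ×̄# - I (v ×)]` of a single body. -/
def bodyFactor (I : Matrix Tw Tw ℝ) (v : Tw → ℝ) : Matrix Tw Tw ℝ :=
  (1 / 2 : ℝ) • (crossForce v * I + crossForceBar (I *ᵥ v) - I * crossMotion v)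

/-! ### Trees of clusters -/

/-- A tree (or forest rooted at the ground) of `N` clusters. Cluster `i` has `bodies i` rigid
bodies and `dof i` generalized speeds. The ground is represented by `none`. Every body of a cluster
is positioned relative to one body of the parent cluster. A tree of rigid bodies is the case in
which every cluster has a single body. -/
structure ClusterTree (N : ℕ) where
  bodies : Fin N → ℕ
  dof : Fin N → ℕ
  parent : Fin N → Option (Fin N)
  parent_lt : ∀ {i j : Fin N}, parent i = some j → j < i
  bodyParent : (Σ i, Fin (bodies i)) → Option (Σ i, Fin (bodies i))
  bodyParent_cluster : ∀ b, (bodyParent b).map Sigma.fst = parent b.1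

namespace ClusterTree

variable {N : ℕ} (t : ClusterTree N)

/-- The bodies of the system. -/
abbrev Body : Type := Σ i, Fin (t.bodies i)

/-- The index set of the stacked twists of cluster `i`. -/
abbrev Row (i : Fin N) : Type := Tw × Fin (t.bodies i)

/-- The index set of the stacked twists of all bodies. -/
abbrev Rows : Type := Σ i, t.Row i

/-- The index set of the minimal generalized speeds. -/
abbrev Speeds : Type := Σ i, Fin (t.dof i)

/-- `t.Precedes c b`: the body `c` is on the path from the body `b` to the ground (`c = b`
included). -/
def Precedes (c b : t.Body) : Prop :=
  Relation.ReflTransGen (fun x y => t.bodyParent x = some y) b c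

/-- The number of clusters on the path from cluster `i` to the ground, `i` included. -/
def level (i : Fin N) : ℕ :=
  match h : t.parent i with
  | none => 1
  | some p => level p + 1
termination_by i
decreasing_by exact t.parent_lt h

/-- The depth of the tree. -/
def depth : ℕ := Finset.univ.sup t.level

end ClusterTree

/-! ### The Coriolis matrix algorithm, with its operation count -/

/-- A result together with the number of elementary operations that were spent on it. -/
structure Timed (α : Type) where
  val : α
  cost : ℕ

namespace Timed

instance : Monad Timed where
  pure a := ⟨a, 0⟩
  bind x f := ⟨(f x.val).val, x.cost + (f x.val).cost⟩

/-- Return `a` at the price of `n` operations. -/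
def tick {α : Type} (n : ℕ) (a : α) : Timed α := ⟨a, n⟩

section Ops

variable {m n p : Type} [Fintype m] [Fintype n] [Fintype p]

/-- Matrix product: a multiplication and an addition for each of the `m n p` terms. -/
def mul (A : Matrix m n ℝ) (B : Matrix n p ℝ) : Timed (Matrix m p ℝ) :=
  tick (2 * (Fintype.card m * Fintype.card n * Fintype.card p)) (A * B)

/-- The product `Aᵀ B`. -/
def tmul (A : Matrix n m ℝ) (B : Matrix n p ℝ) : Timed (Matrix m p ℝ) :=
  tick (2 * (Fintype.card m * Fintype.card n * Fintype.card p)) (Aᵀ * B)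

/-- Matrix-vector product. -/
def mulVec (A : Matrix m n ℝ) (x : n → ℝ) : Timed (m → ℝ) :=
  tick (2 * (Fintype.card m * Fintype.card n)) (A *ᵥ x)

/-- Entrywise sum of matrices. -/
def plus (A B : Matrix m n ℝ) : Timed (Matrix m n ℝ) :=
  tick (Fintype.card m * Fintype.card n) (A + B)

/-- Entrywise sum of vectors. -/
def plusVec (x y : m → ℝ) : Timed (m → ℝ) := tick (Fintype.card m) (x + y)

/-- Entrywise difference of matrices. -/
def minus (A B : Matrix m n ℝ) : Timed (Matrix m n ℝ) :=
  tick (Fintype.card m * Fintype.card n) (A - B)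

/-- Scaling of a matrix. -/
def scale (a : ℝ) (A : Matrix m n ℝ) : Timed (Matrix m n ℝ) :=
  tick (Fintype.card m * Fintype.card n) (a • A)

/-- Transposition, or any other writing down of a matrix, at the price of one operation per entry
(for the cross-product matrices, whose entries are at most signed entries of the argument). -/
def write (A : Matrix m n ℝ) : Timed (Matrix m n ℝ) :=
  tick (Fintype.card m * Fintype.card n) A

end Ops

end Timed

/-- The input of the algorithm: the transforms from each cluster to its parent, the joint mode
matrices and their rates of change in local coordinates, the inertias of the bodies, and the
generalized speeds of the joints. -/
structure AlgInput {N : ℕ} (t : ClusterTree N) where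
  toParent : ∀ i j : Fin N, t.parent i = some j → Matrix (t.Row i) (t.Row j) ℝ
  modes : ∀ i, Matrix (t.Row i) (Fin (t.dof i)) ℝ
  modesRate : ∀ i, Matrix (t.Row i) (Fin (t.dof i)) ℝ
  inertia : ∀ i, Fin (t.bodies i) → Matrix Tw Tw ℝ
  speeds : ∀ i, Fin (t.dof i) → ℝ

/-- The variables of the algorithm. -/
structure AlgState {N : ℕ} (t : ClusterTree N) where
  v : ∀ i, t.Row i → ℝ
  modesDot : ∀ i, Matrix (t.Row i) (Fin (t.dof i)) ℝ
  IC : ∀ i, Matrix (t.Row i) (t.Row i) ℝ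
  BC : ∀ i, Matrix (t.Row i) (t.Row i) ℝ
  C : ∀ i j, Matrix (Fin (t.dof i)) (Fin (t.dof j)) ℝ

namespace Alg

variable {N : ℕ} {t : ClusterTree N} (inp : AlgInput t)

open Timed

/-- All variables are zero at the start. -/
def init (t : ClusterTree N) : AlgState t where
  v := fun _ => 0
  modesDot := fun _ => 0
  IC := fun _ => 0
  BC := fun _ => 0
  C := fun _ _ => 0

/-- The twist of cluster `i`; the ground is at rest. -/
def twistStep (v : ∀ i, t.Row i → ℝ) (i : Fin N) : Timed (t.Row i → ℝ) := do
  let own ← mulVec (inp.modes i) (inp.speeds i)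
  match h : t.parent i with
  | none => pure own
  | some p => do
    let carried ← mulVec (inp.toParent i p h) (v p)
    plusVec carried own

/-- One pass of the forward loop. -/
def forwardStep (s : AlgState t) (i : Fin N) : Timed (AlgState t) := do
  let vi ← twistStep inp s.v i
  let cr ← write (clusterCross vi)
  let d₁ ← mul cr (inp.modes i)
  let d ← plus d₁ (inp.modesRate i)
  let I ← write (Matrix.blockDiagonal (inp.inertia i))
  let crf ← write (clusterCrossForce vi)
  let b₁ ← mul crf I
  let h ← mulVec I vi
  let b₂ ← write (clusterCrossForceBar h)
  let b₃ ← mul I cr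
  let b₄ ← plus b₁ b₂
  let b₅ ← minus b₄ b₃
  let B ← scale (1 / 2) b₅
  pure { s with
    v := Function.update s.v i vi
    modesDot := Function.update s.modesDot i d
    IC := Function.update s.IC i I
    BC := Function.update s.BC i B }

/-- Assignment to the block `(i, j)` of the output. -/
def setBlock (C : ∀ i j, Matrix (Fin (t.dof i)) (Fin (t.dof j)) ℝ) (i j : Fin N)
    (M : Matrix (Fin (t.dof i)) (Fin (t.dof j)) ℝ) :
    Timed (∀ i j, Matrix (Fin (t.dof i)) (Fin (t.dof j)) ℝ) :=
  tick (t.dof i * t.dof j) (Function.update C i (Function.update (C i) j M))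

/-- The inner loop: climb from cluster `i` to the ground and fill in the blocks `(p, j)` and
`(j, p)` for all `p` that are met on the way. -/
def climb (modesDot : ∀ i, Matrix (t.Row i) (Fin (t.dof i)) ℝ) (j i : Fin N)
    (f₁ f₂ f₃ : Matrix (t.Row i) (Fin (t.dof j)) ℝ)
    (C : ∀ i j, Matrix (Fin (t.dof i)) (Fin (t.dof j)) ℝ) :
    Timed (∀ i j, Matrix (Fin (t.dof i)) (Fin (t.dof j)) ℝ) :=
  match h : t.parent i with
  | none => tick 1 C
  | some p => do
    let _ ← tick 1 ()
    let g₁ ← tmul (inp.toParent i p h) f₁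
    let g₂ ← tmul (inp.toParent i p h) f₂
    let g₃ ← tmul (inp.toParent i p h) f₃
    let up ← tmul (inp.modes p) g₁
    let C₁ ← setBlock C p j up
    let l₁ ← tmul (modesDot p) g₂
    let l₂ ← tmul (inp.modes p) g₃
    let l₃ ← plus l₁ l₂
    let low ← write l₃ᵀ
    let C₂ ← setBlock C₁ j p low
    climb modesDot j p g₁ g₂ g₃ C₂
termination_by i
decreasing_by exact t.parent_lt h

/-- Add the composite matrix of cluster `j` to that of its parent. -/
def accumulate (M : ∀ i, Matrix (t.Row i) (t.Row i) ℝ) (j : Fin N) :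
    Timed (∀ i, Matrix (t.Row i) (t.Row i) ℝ) :=
  match h : t.parent j with
  | none => tick 1 M
  | some p => do
    let m₁ ← mul (M j) (inp.toParent j p h)
    let m₂ ← tmul (inp.toParent j p h) m₁
    let m₃ ← plus (M p) m₂
    pure (Function.update M p m₃)

/-- One pass of the backward loop. -/
def backwardStep (s : AlgState t) (j : Fin N) : Timed (AlgState t) := do
  let a ← mul (s.IC j) (s.modesDot j)
  let b ← mul (s.BC j) (inp.modes j)
  let f₁ ← plus a b
  let f₂ ← mul (s.IC j) (inp.modes j)
  let f₃ ← tmul (s.BC j) (inp.modes j)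
  let c ← tmul (inp.modes j) f₁
  let C₁ ← setBlock s.C j j c
  let C₂ ← climb inp s.modesDot j j f₁ f₂ f₃ C₁
  let IC ← accumulate inp s.IC j
  let BC ← accumulate inp s.BC j
  pure { s with C := C₂, IC := IC, BC := BC }

/-- The torsion-free Coriolis matrix algorithm. -/
def coriolis : Timed (Matrix t.Speeds t.Speeds ℝ) := do
  let s₁ ← (List.finRange N).foldlM (forwardStep inp) (init t)
  let s₂ ← (List.finRange N).reverse.foldlM (backwardStep inp) s₁
  pure (Matrix.of fun a b => s₂.C a.1 b.1 a.2 b.2)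

end Alg

/-! ### Multibody systems -/

section Geometry

variable {E : Type*} [NormedAddCommGroup E] [NormedSpace ℝ E]
  {Q : Type*} [TopologicalSpace Q] [ChartedSpace E Q]

/-- The derivative of a real function `f` at `q` in the direction `u`. -/
def dirDeriv (f : Q → ℝ) (q : Q) (u : TangentSpace 𝓘(ℝ, E) q) : ℝ :=
  mvfderiv 𝓘(ℝ, E) f q u

/-- A smooth map into `SE(3)`. -/
def SmoothPose (E : Type*) [NormedAddCommGroup E] [NormedSpace ℝ E]
    {Q : Type*} [TopologicalSpace Q] [ChartedSpace E Q] (T : Q → Pose) : Prop :=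
  ∀ r c, ContMDiff 𝓘(ℝ, E) 𝓘(ℝ, ℝ) ∞ fun q => (T q).toMatrix r c

/-- The body twist of a configuration-dependent pose `T` when the configuration `q` moves with
velocity `u`: the coordinates of the element `T⁻¹ Ṫ` of `se(3)`. -/
def bodyTwist (T : Q → Pose) (q : Q) (u : TangentSpace 𝓘(ℝ, E) q) : Tw → ℝ :=
  vee ((T q).inv.toMatrix * Matrix.of fun r c => dirDeriv (fun x => (T x).toMatrix r c) q u)

/-- The pose of a body relative to its parent body (or to the ground). -/
def relPose {N : ℕ} (t : ClusterTree N) (pose : t.Body → Q → Pose) (b : t.Body) (q : Q) : Pose :=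
  match t.bodyParent b with
  | none => pose b q
  | some c => (pose c q).inv.mul (pose b q)

/-- A system of rigid bodies with configuration manifold `Q` whose bodies are joined in a tree of
clusters. The generalized speeds are taken along a smooth frame of `Q`. The field `joint_local` says
that the speeds of the joint of cluster `i` only move the bodies of cluster `i` relative to
the parent cluster: they leave all other joints at rest. -/
structure MultibodySystem {N : ℕ} (t : ClusterTree N) (E : Type*) [NormedAddCommGroup E]
    [NormedSpace ℝ E] (Q : Type*) [TopologicalSpace Q] [ChartedSpace E Q]
    [IsManifold 𝓘(ℝ, E) ∞ Q] where
  body : t.Body → RigidBody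
  pose : t.Body → Q → Pose
  pose_smooth : ∀ b, SmoothPose E (pose b)
  frame : t.Speeds → ∀ q : Q, TangentSpace 𝓘(ℝ, E) q
  frame_smooth : ∀ a, ContMDiff 𝓘(ℝ, E) 𝓘(ℝ, E).tangent ∞
    fun q => (⟨q, frame a q⟩ : TangentBundle 𝓘(ℝ, E) Q)
  frame_linearIndependent : ∀ q, LinearIndependent ℝ fun a => frame a q
  frame_span : ∀ q, Submodule.span ℝ (Set.range fun a => frame a q) = ⊤
  joint_local : ∀ (a : t.Speeds) (b : t.Body), b.1 ≠ a.1 →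
    ∀ q, bodyTwist (relPose t pose b) q (frame a q) = 0

namespace MultibodySystem

variable [IsManifold 𝓘(ℝ, E) ∞ Q] {N : ℕ} {t : ClusterTree N} (S : MultibodySystem t E Q)

/-- The configuration velocity `q̇ = Σ v̄ᵃ X̄ₐ(q)`. -/
def velocity (q : Q) (vbar : t.Speeds → ℝ) : TangentSpace 𝓘(ℝ, E) q :=
  ∑ a, vbar a • S.frame a q

/-- The stacked body twists of cluster `i`. -/
def clusterTwist (q : Q) (vbar : t.Speeds → ℝ) (i : Fin N) : t.Row i → ℝ :=
  fun r => bodyTwist (S.pose ⟨i, r.2⟩) q (S.velocity q vbar) r.1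

/-- The stacked body twists `v` of all bodies. -/
def twists (q : Q) (vbar : t.Speeds → ℝ) : t.Rows → ℝ :=
  fun r => S.clusterTwist q vbar r.1 r.2

/-- The kinetic-energy metric: the sum over all bodies of `v_bᵀ I_b w_b`, where `v_b` and `w_b` are
the twists of body `b` for the configuration velocities `u` and `w`. -/
def metric (q : Q) (u w : TangentSpace 𝓘(ℝ, E) q) : ℝ :=
  ∑ b, bodyTwist (S.pose b) q u ⬝ᵥ (S.body b).inertia *ᵥ bodyTwist (S.pose b) q w

/-- The mass matrix `H̄ᵢⱼ = ⟨X̄ᵢ, X̄ⱼ⟩` with respect to the minimal speeds. -/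
def massMatrix (q : Q) : Matrix t.Speeds t.Speeds ℝ :=
  Matrix.of fun i j => S.metric q (S.frame i q) (S.frame j q)

/-- The generalized Christoffel symbols (of the first kind) of the kinetic-energy metric with
respect to the frame. -/
def christoffel (q : Q) (i j k : t.Speeds) : ℝ :=
  (1 / 2) *
    (dirDeriv (fun x => S.massMatrix x i j) q (S.frame k q)
      + dirDeriv (fun x => S.massMatrix x i k) q (S.frame j q)
      - dirDeriv (fun x => S.massMatrix x j k) q (S.frame i q)
      + S.metric q (S.frame k q)
          (VectorField.mlieBracket 𝓘(ℝ, E) (S.frame i) (S.frame j) q)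
      + S.metric q (S.frame j q)
          (VectorField.mlieBracket 𝓘(ℝ, E) (S.frame i) (S.frame k) q)
      + S.metric q (S.frame i q)
          (VectorField.mlieBracket 𝓘(ℝ, E) (S.frame j) (S.frame k) q))

/-- The Christoffel-consistent Coriolis matrix `C̄*ᵢₖ = Σⱼ Γ̄*ᵢⱼₖ v̄ʲ`. -/
def coriolisStar (q : Q) (vbar : t.Speeds → ℝ) : Matrix t.Speeds t.Speeds ℝ :=
  Matrix.of fun i k => ∑ j, S.christoffel q i j k * vbar j

/-- An affine connection on `Q` is the Riemannian connection of the kinetic-energy metric if it is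
torsion-free and compatible with the metric. Here `cov Y q (X q)` is `∇_X Y` at `q`. -/
structure IsRiemannianConnection
    (cov : CovariantDerivative 𝓘(ℝ, E) E (fun q : Q => TangentSpace 𝓘(ℝ, E) q)) : Prop where
  torsion_free : ∀ (X Y : ∀ q : Q, TangentSpace 𝓘(ℝ, E) q),
    ContMDiff 𝓘(ℝ, E) 𝓘(ℝ, E).tangent ∞ (fun q => (⟨q, X q⟩ : TangentBundle 𝓘(ℝ, E) Q)) →
    ContMDiff 𝓘(ℝ, E) 𝓘(ℝ, E).tangent ∞ (fun q => (⟨q, Y q⟩ : TangentBundle 𝓘(ℝ, E) Q)) →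
    ∀ q, cov Y q (X q) - cov X q (Y q) = VectorField.mlieBracket 𝓘(ℝ, E) X Y q
  metric_compatible : ∀ (X Y Z : ∀ q : Q, TangentSpace 𝓘(ℝ, E) q),
    ContMDiff 𝓘(ℝ, E) 𝓘(ℝ, E).tangent ∞ (fun q => (⟨q, X q⟩ : TangentBundle 𝓘(ℝ, E) Q)) →
    ContMDiff 𝓘(ℝ, E) 𝓘(ℝ, E).tangent ∞ (fun q => (⟨q, Y q⟩ : TangentBundle 𝓘(ℝ, E) Q)) →
    ContMDiff 𝓘(ℝ, E) 𝓘(ℝ, E).tangent ∞ (fun q => (⟨q, Z q⟩ : TangentBundle 𝓘(ℝ, E) Q)) →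
    ∀ q, dirDeriv (fun x => S.metric x (Y x) (Z x)) q (X q)
      = S.metric q (cov Y q (X q)) (Z q) + S.metric q (Y q) (cov Z q (X q))

open Classical in
/-- The block matrix `X` of spatial transforms: for bodies `b` and `c`, its block is the adjoint
matrix of the pose of the frame of `c` relative to the frame of `b` if `c` is on the path from `b`
to the ground, and zero otherwise. -/
def transform (q : Q) : Matrix t.Rows t.Rows ℝ :=
  Matrix.of fun r c =>
    if t.Precedes ⟨c.1, c.2.2⟩ ⟨r.1, r.2.2⟩ then
      ((S.pose ⟨r.1, r.2.2⟩ q).inv.mul (S.pose ⟨c.1, c.2.2⟩ q)).Ad r.2.1 c.2.1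
    else 0

/-- The joint mode matrix of cluster `i`: its column `a` lists the twists of the bodies of the
cluster relative to their parent bodies when the speed `a` of the joint is one and all other speeds
vanish. -/
def jointModes (i : Fin N) (q : Q) : Matrix (t.Row i) (Fin (t.dof i)) ℝ :=
  Matrix.of fun r a => bodyTwist (relPose t S.pose ⟨i, r.2⟩) q (S.frame ⟨i, a⟩ q) r.1

/-- The rate of change of the joint mode matrix in local coordinates. -/
def jointModesRate (i : Fin N) (q : Q) (vbar : t.Speeds → ℝ) :
    Matrix (t.Row i) (Fin (t.dof i)) ℝ :=
  Matrix.of fun r a => dirDeriv (fun x => S.jointModes i x r a) q (S.velocity q vbar)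

/-- `Φ = BlockDiag(Φ₁, …, Φ_N)`. -/
def modes (q : Q) : Matrix t.Rows t.Speeds ℝ :=
  Matrix.blockDiagonal' fun i => S.jointModes i q

/-- `Φ̇ = (v ×) Φ + Φ̊`, the inertial rate of change of the joint modes. -/
def modesDot (q : Q) (vbar : t.Speeds → ℝ) : Matrix t.Rows t.Speeds ℝ :=
  (Matrix.blockDiagonal' fun i => clusterCross (S.clusterTwist q vbar i)) * S.modes q
    + Matrix.blockDiagonal' fun i => S.jointModesRate i q vbar

/-- The block-diagonal inertia matrix `H` of the free bodies. -/
def inertia : Matrix t.Rows t.Rows ℝ :=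
  Matrix.blockDiagonal' fun i => Matrix.blockDiagonal fun b => (S.body ⟨i, b⟩).inertia

/-- The block-diagonal matrix `B` of the Niemeyer–Slotine factors of the bodies. -/
def factor (q : Q) (vbar : t.Speeds → ℝ) : Matrix t.Rows t.Rows ℝ :=
  Matrix.blockDiagonal' fun i => Matrix.blockDiagonal fun b =>
    bodyFactor (S.body ⟨i, b⟩).inertia fun r => S.clusterTwist q vbar i (r, b)

/-- The data that the algorithm receives at the state `(q, v̄)`. -/
def algInput (q : Q) (vbar : t.Speeds → ℝ) : AlgInput t where
  toParent := fun i j _ => (S.transform q).submatrix (Sigma.mk i) (Sigma.mk j)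
  modes := fun i => S.jointModes i q
  modesRate := fun i => S.jointModesRate i q vbar
  inertia := fun i b => (S.body ⟨i, b⟩).inertia
  speeds := fun i a => vbar ⟨i, a⟩

end MultibodySystem

end Geometry

end Multibody

end

/-! For a body with pose `T`, the twist is the `se(3)`-valued one-form `T⁻¹ dT`. Differentiating `T`
twice and antisymmetrising gives the Maurer–Cartan equation `bodyTwist_mlieBracket`: the twist along
`[X, Y]` is the commutator of the derivatives of the twists along `X` and `Y`, plus the spatial
cross product of these twists. Write `x_k` for the twist of a body along the frame field `k`. The
mass matrix is the sum over the bodies of `x_iᵀ I x_j`. Once Maurer–Cartan replaces the brackets in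
the Christoffel symbols, the derivatives of twists cancel except for `x_iᵀ I (L_j x_k)`, and three
cross-product terms remain (`christoffel_eq`). Contracted with the speeds, these terms are the
Niemeyer–Slotine factor plus `x_iᵀ I (v × x_k)` (`coriolisStar_apply`).

The tree enters through recursions. The twist of a body is the transported twist of its parent body
plus the relative twist, and `X` solves every recursion of this shape (`transform_mulVec_eq`). Hence
the columns of `XΦ` are the `x_k`. Differentiated in the ground frame, the recursion keeps its
transforms and its source becomes `Φ̇`; hence the columns of `XΦ̇` are `v × x_k` plus the derivative
of `x_k` along the motion. This turns the bodywise formula into the matrix factorisation. The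
statement about the connection is Koszul's formula read backwards.

For the algorithm, the block `(a, b)` of `Xᵀ M X` with `M` block diagonal is a sum over the common
descendants of `a` and `b`. It vanishes unless one of them is an ancestor of the other, and is
otherwise a transported diagonal block. The diagonal blocks are the composite matrices of the
backward loop, complete when their cluster is reached because children have larger indices than
parents. Each climb has at most `d` passes, each of bounded cost, which gives the operation count.
-/

noncomputable section

namespace Multibody

/-! ### Lie brackets as commutators of derivations. -/

section Derivations

variable {E : Type*} [NormedAddCommGroup E] [NormedSpace ℝ E]
  {Q : Type*} [TopologicalSpace Q] [ChartedSpace E Q]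

theorem contMDiff_dirDeriv [IsManifold 𝓘(ℝ, E) ∞ Q] {f : Q → ℝ}
    (hf : ContMDiff 𝓘(ℝ, E) 𝓘(ℝ, ℝ) ∞ f) {X : ∀ q : Q, TangentSpace 𝓘(ℝ, E) q}
    (hX : ContMDiff 𝓘(ℝ, E) 𝓘(ℝ, E).tangent ∞
      fun q => (⟨q, X q⟩ : TangentBundle 𝓘(ℝ, E) Q)) :
    ContMDiff 𝓘(ℝ, E) 𝓘(ℝ, ℝ) ∞ fun q => dirDeriv f q (X q) :=
  (contMDiff_snd_tangentBundle_modelSpace ℝ 𝓘(ℝ, ℝ)).comp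
    ((hf.contMDiff_tangentMap (m := ∞) (by simp)).comp hX)

/-- Chain rule: the pullback applies the inverse of the derivative of the inverse chart, which
cancels. The identity is needed on the whole chart target, not just at the image of `q`, because it
is differentiated once more. -/
theorem dirDeriv_eq_fderiv_chart [IsManifold 𝓘(ℝ, E) ∞ Q] {f : Q → ℝ}
    (hf : ContMDiff 𝓘(ℝ, E) 𝓘(ℝ, ℝ) ∞ f) (X : ∀ q : Q, TangentSpace 𝓘(ℝ, E) q) (q : Q)
    {y : E} (hy : y ∈ (extChartAt 𝓘(ℝ, E) q).target) :
    dirDeriv f ((extChartAt 𝓘(ℝ, E) q).symm y) (X ((extChartAt 𝓘(ℝ, E) q).symm y)) =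
      fderiv ℝ (f ∘ (extChartAt 𝓘(ℝ, E) q).symm) y
        (VectorField.mpullbackWithin 𝓘(ℝ, E) 𝓘(ℝ, E) (extChartAt 𝓘(ℝ, E) q).symm X
          (Set.range 𝓘(ℝ, E)) y) := by
  have hsymm := isInvertible_mfderivWithin_extChartAt_symm (I := 𝓘(ℝ, E)) hy
  have hd : MDifferentiableWithinAt 𝓘(ℝ, E) 𝓘(ℝ, E) (extChartAt 𝓘(ℝ, E) q).symm
      (Set.range 𝓘(ℝ, E)) y := mdifferentiableWithinAt_of_isInvertible_mfderivWithin hsymm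
  have hfd : MDifferentiableAt 𝓘(ℝ, E) 𝓘(ℝ, ℝ) f ((extChartAt 𝓘(ℝ, E) q).symm y) :=
    (hf _).mdifferentiableAt (by simp)
  have hu : UniqueMDiffWithinAt 𝓘(ℝ, E) (Set.range 𝓘(ℝ, E)) y := by
    simpa using uniqueMDiffWithinAt_univ 𝓘(ℝ, E)
  have hcomp := mfderiv_comp_mfderivWithin y hfd hd hu
  have h1 : fderiv ℝ (f ∘ (extChartAt 𝓘(ℝ, E) q).symm) y =
      mfderivWithin 𝓘(ℝ, E) 𝓘(ℝ, ℝ) (f ∘ (extChartAt 𝓘(ℝ, E) q).symm)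
        (Set.range 𝓘(ℝ, E)) y := by
    simp
  rw [h1, hcomp, VectorField.mpullbackWithin_apply]
  exact congrArg _ (hsymm.self_apply_inverse _).symm

/-- The derivation along a Lie bracket is the commutator of the derivations. -/
theorem dirDeriv_mlieBracket [CompleteSpace E] [IsManifold 𝓘(ℝ, E) ∞ Q] {f : Q → ℝ}
    (hf : ContMDiff 𝓘(ℝ, E) 𝓘(ℝ, ℝ) ∞ f) {X Y : ∀ q : Q, TangentSpace 𝓘(ℝ, E) q}
    (hX : ContMDiff 𝓘(ℝ, E) 𝓘(ℝ, E).tangent ∞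
      fun q => (⟨q, X q⟩ : TangentBundle 𝓘(ℝ, E) Q))
    (hY : ContMDiff 𝓘(ℝ, E) 𝓘(ℝ, E).tangent ∞
      fun q => (⟨q, Y q⟩ : TangentBundle 𝓘(ℝ, E) Q)) (q : Q) :
    dirDeriv f q (VectorField.mlieBracket 𝓘(ℝ, E) X Y q) =
      dirDeriv (fun x => dirDeriv f x (Y x)) q (X q)
        - dirDeriv (fun x => dirDeriv f x (X x)) q (Y q) := by
  have hat : ∀ {g : Q → ℝ}, ContMDiff 𝓘(ℝ, E) 𝓘(ℝ, ℝ) ∞ g → ∀ v : E,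
      dirDeriv g q v = fderiv ℝ (g ∘ (extChartAt 𝓘(ℝ, E) q).symm) (extChartAt 𝓘(ℝ, E) q q) v := by
    intro g hg v
    have h := ((hg q).mdifferentiableAt (by simp)).mvfderiv
    simp only [modelWithCornersSelf_coe, Set.range_id, fderivWithin_univ] at h
    exact DFunLike.congr_fun h v
  -- At the base point the derivatives of the chart and of its inverse are the identity, so
  -- pullbacks do not change vectors there.
  have hid : ∀ A : E →L[ℝ] E, A = ContinuousLinearMap.id ℝ E → ∀ v, A.inverse v = v := by
    rintro _ rfl v
    simp
  have hpull : ∀ Z : ∀ q : Q, TangentSpace 𝓘(ℝ, E) q,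
      VectorField.mpullbackWithin 𝓘(ℝ, E) 𝓘(ℝ, E) (extChartAt 𝓘(ℝ, E) q).symm Z
        (Set.range 𝓘(ℝ, E)) (extChartAt 𝓘(ℝ, E) q q) = (Z q : E) := by
    intro Z
    exact (hid _ mfderivWithin_range_extChartAt_symm _).trans
      (congrArg (fun x => (Z x : E)) (extChartAt_to_inv (I := 𝓘(ℝ, E)) q))
  have hder : ∀ Z : ∀ q : Q, TangentSpace 𝓘(ℝ, E) q,
      ((fun x => dirDeriv f x (Z x)) ∘ (extChartAt 𝓘(ℝ, E) q).symm) =ᶠ[nhds (extChartAt 𝓘(ℝ, E) q q)]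
        fun y => fderiv ℝ (f ∘ (extChartAt 𝓘(ℝ, E) q).symm) y
          (VectorField.mpullbackWithin 𝓘(ℝ, E) 𝓘(ℝ, E) (extChartAt 𝓘(ℝ, E) q).symm Z
            (Set.range 𝓘(ℝ, E)) y) := by
    intro Z
    filter_upwards [extChartAt_target_mem_nhds (I := 𝓘(ℝ, E)) q] with y hy
    exact dirDeriv_eq_fderiv_chart hf Z q hy
  have hdiff : ∀ {Z : ∀ q : Q, TangentSpace 𝓘(ℝ, E) q}, (ContMDiff 𝓘(ℝ, E) 𝓘(ℝ, E).tangent ∞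
      fun q => (⟨q, Z q⟩ : TangentBundle 𝓘(ℝ, E) Q)) →
      DifferentiableAt ℝ (VectorField.mpullbackWithin 𝓘(ℝ, E) 𝓘(ℝ, E)
        (extChartAt 𝓘(ℝ, E) q).symm Z (Set.range 𝓘(ℝ, E)) : E → E) (extChartAt 𝓘(ℝ, E) q q) := by
    intro Z hZ
    have h := ((hZ q).mdifferentiableAt (by simp)).mdifferentiableWithinAt (s := Set.univ)
      |>.differentiableWithinAt_mpullbackWithin_vectorField
    simp only [modelWithCornersSelf_coe, Set.range_id, Set.preimage_univ, Set.univ_inter] at h ⊢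
    exact differentiableWithinAt_univ.1 h
  have hF : ContDiffAt ℝ ∞ (f ∘ (extChartAt 𝓘(ℝ, E) q).symm) (extChartAt 𝓘(ℝ, E) q q) := by
    have h := (contMDiffAt_iff.1 (hf q)).2
    simp only [modelWithCornersSelf_coe, Set.range_id, contDiffWithinAt_univ] at h
    exact h
  have hbr : (VectorField.mlieBracket 𝓘(ℝ, E) X Y q : E) = VectorField.lieBracket ℝ
      (VectorField.mpullbackWithin 𝓘(ℝ, E) 𝓘(ℝ, E) (extChartAt 𝓘(ℝ, E) q).symm X
        (Set.range 𝓘(ℝ, E)))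
      (VectorField.mpullbackWithin 𝓘(ℝ, E) 𝓘(ℝ, E) (extChartAt 𝓘(ℝ, E) q).symm Y
        (Set.range 𝓘(ℝ, E))) (extChartAt 𝓘(ℝ, E) q q) := by
    rw [← VectorField.mlieBracketWithin_univ]
    refine (VectorField.mlieBracketWithin_apply (I := 𝓘(ℝ, E))).trans ?_
    refine (hid _ mfderiv_extChartAt_self _).trans ?_
    simp only [modelWithCornersSelf_coe, Set.range_id, Set.preimage_univ, Set.univ_inter]
    exact congrFun VectorField.lieBracketWithin_univ _
  -- In the chart this is the symmetry of the second derivative of a function on `E`.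
  have h := VectorField.fderiv_apply_lieBracket hF
    (by rw [minSmoothness_of_isRCLikeNormedField]; exact WithTop.coe_le_coe.2 (le_top : (2 : ℕ∞) ≤ ⊤)) (hdiff hY) (hdiff hX)
  rw [hpull, hpull, ← (hder Y).fderiv_eq, ← (hder X).fderiv_eq] at h
  refine (hat hf _).trans ?_
  rw [hbr]
  refine h.trans (congrArg₂ _ (hat (contMDiff_dirDeriv hf hY) _).symm
    (hat (contMDiff_dirDeriv hf hX) _).symm)

end Derivations

/-! ### Entrywise differential calculus for matrix-valued and vector-valued functions. -/

section DerivativeRules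

variable {E : Type*} [NormedAddCommGroup E] [NormedSpace ℝ E]
  {Q : Type*} [TopologicalSpace Q] [ChartedSpace E Q]

theorem dirDeriv_const (c : ℝ) (q : Q) (u : TangentSpace 𝓘(ℝ, E) q) :
    dirDeriv (fun _ => c) q u = 0 := by
  simp [dirDeriv, mvfderiv_const]

theorem dirDeriv_add_fun {f g : Q → ℝ} (hf : ContMDiff 𝓘(ℝ, E) 𝓘(ℝ, ℝ) ∞ f)
    (hg : ContMDiff 𝓘(ℝ, E) 𝓘(ℝ, ℝ) ∞ g) (q : Q) (u : TangentSpace 𝓘(ℝ, E) q) :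
    dirDeriv (fun x => f x + g x) q u = dirDeriv f q u + dirDeriv g q u := by
  simp [dirDeriv, mvfderiv_fun_add ((hf q).mdifferentiableAt (by simp))
    ((hg q).mdifferentiableAt (by simp))]

theorem dirDeriv_mul_fun {f g : Q → ℝ} (hf : ContMDiff 𝓘(ℝ, E) 𝓘(ℝ, ℝ) ∞ f)
    (hg : ContMDiff 𝓘(ℝ, E) 𝓘(ℝ, ℝ) ∞ g) (q : Q) (u : TangentSpace 𝓘(ℝ, E) q) :
    dirDeriv (fun x => f x * g x) q u = dirDeriv f q u * g q + f q * dirDeriv g q u := by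
  simp [dirDeriv, mvfderiv_fun_mul ((hf q).mdifferentiableAt (by simp))
    ((hg q).mdifferentiableAt (by simp))]
  ring

theorem dirDeriv_neg_fun (f : Q → ℝ) (q : Q) (u : TangentSpace 𝓘(ℝ, E) q) :
    dirDeriv (fun x => -f x) q u = -dirDeriv f q u := by
  simp [dirDeriv, mvfderiv_fun_neg]

theorem contMDiff_sum_fun {ι : Type*} {s : Finset ι} {f : ι → Q → ℝ}
    (hf : ∀ i ∈ s, ContMDiff 𝓘(ℝ, E) 𝓘(ℝ, ℝ) ∞ (f i)) :
    ContMDiff 𝓘(ℝ, E) 𝓘(ℝ, ℝ) ∞ fun x => ∑ i ∈ s, f i x :=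
  contMDiff_finsetSum hf

theorem dirDeriv_sum_fun {ι : Type*} {s : Finset ι} {f : ι → Q → ℝ}
    (hf : ∀ i ∈ s, ContMDiff 𝓘(ℝ, E) 𝓘(ℝ, ℝ) ∞ (f i)) (q : Q)
    (u : TangentSpace 𝓘(ℝ, E) q) :
    dirDeriv (fun x => ∑ i ∈ s, f i x) q u = ∑ i ∈ s, dirDeriv (f i) q u := by
  classical
  induction s using Finset.induction_on with
  | empty => simp [dirDeriv_const]
  | insert a s ha ih =>
    simp only [Finset.sum_insert ha]
    rw [dirDeriv_add_fun (hf a (by simp))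
      (contMDiff_sum_fun fun i hi => hf i (Finset.mem_insert_of_mem hi)),
      ih fun i hi => hf i (Finset.mem_insert_of_mem hi)]

theorem dirDeriv_sum_mul {ι : Type*} [Fintype ι] {f g : ι → Q → ℝ}
    (hf : ∀ i, ContMDiff 𝓘(ℝ, E) 𝓘(ℝ, ℝ) ∞ (f i)) (hg : ∀ i, ContMDiff 𝓘(ℝ, E) 𝓘(ℝ, ℝ) ∞ (g i))
    (q : Q) (u : TangentSpace 𝓘(ℝ, E) q) :
    dirDeriv (fun x => ∑ i, f i x * g i x) q u =
      ∑ i, dirDeriv (f i) q u * g i q + ∑ i, f i q * dirDeriv (g i) q u := by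
  have h := dirDeriv_sum_fun (s := Finset.univ) (f := fun i x => f i x * g i x)
    (fun i _ => (hf i).mul (hg i)) q u
  rw [h, ← Finset.sum_add_distrib]
  exact Finset.sum_congr rfl fun i _ => dirDeriv_mul_fun (hf i) (hg i) q u

theorem dirDeriv_add (f : Q → ℝ) (q : Q) (u w : TangentSpace 𝓘(ℝ, E) q) :
    dirDeriv f q (u + w) = dirDeriv f q u + dirDeriv f q w := map_add _ _ _

theorem dirDeriv_smul (f : Q → ℝ) (q : Q) (a : ℝ) (u : TangentSpace 𝓘(ℝ, E) q) :
    dirDeriv f q (a • u) = a * dirDeriv f q u := map_smul _ _ _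

theorem dirDeriv_sum {ι : Type*} (s : Finset ι) (f : Q → ℝ) (q : Q)
    (u : ι → TangentSpace 𝓘(ℝ, E) q) :
    dirDeriv f q (∑ i ∈ s, u i) = ∑ i ∈ s, dirDeriv f q (u i) := map_sum _ _ _

/-- A matrix-valued function with smooth entries. -/
def SmoothMatrix (E : Type*) [NormedAddCommGroup E] [NormedSpace ℝ E]
    {Q : Type*} [TopologicalSpace Q] [ChartedSpace E Q] {m n : Type*}
    (A : Q → Matrix m n ℝ) : Prop :=
  ∀ r c, ContMDiff 𝓘(ℝ, E) 𝓘(ℝ, ℝ) ∞ fun q => A q r c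

/-- The entrywise derivative of a matrix-valued function. -/
def matDeriv {m n : Type*} (A : Q → Matrix m n ℝ) (q : Q) (u : TangentSpace 𝓘(ℝ, E) q) :
    Matrix m n ℝ :=
  Matrix.of fun r c => dirDeriv (fun x => A x r c) q u

/-- A vector-valued function with smooth entries. -/
def SmoothVec (E : Type*) [NormedAddCommGroup E] [NormedSpace ℝ E]
    {Q : Type*} [TopologicalSpace Q] [ChartedSpace E Q] {m : Type*} (w : Q → m → ℝ) : Prop :=
  ∀ r, ContMDiff 𝓘(ℝ, E) 𝓘(ℝ, ℝ) ∞ fun q => w q r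

/-- The entrywise derivative of a vector-valued function. -/
def vecDeriv {m : Type*} (w : Q → m → ℝ) (q : Q) (u : TangentSpace 𝓘(ℝ, E) q) : m → ℝ :=
  fun r => dirDeriv (fun x => w x r) q u

section

variable {l m n : Type*}

theorem SmoothMatrix.mul [Fintype m] {A : Q → Matrix l m ℝ} {B : Q → Matrix m n ℝ}
    (hA : SmoothMatrix E A) (hB : SmoothMatrix E B) : SmoothMatrix E fun q => A q * B q := by
  intro r c
  simp only [Matrix.mul_apply]
  exact contMDiff_sum_fun fun i _ => (hA r i).mul (hB i c)

theorem SmoothMatrix.mulVec [Fintype m] {A : Q → Matrix l m ℝ} {w : Q → m → ℝ}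
    (hA : SmoothMatrix E A) (hw : SmoothVec E w) : SmoothVec E fun q => A q *ᵥ w q := by
  intro r
  simp only [Matrix.mulVec, dotProduct]
  exact contMDiff_sum_fun fun i _ => (hA r i).mul (hw i)

theorem matDeriv_mul [Fintype m] {A : Q → Matrix l m ℝ} {B : Q → Matrix m n ℝ}
    (hA : SmoothMatrix E A) (hB : SmoothMatrix E B) (q : Q) (u : TangentSpace 𝓘(ℝ, E) q) :
    matDeriv (fun x => A x * B x) q u = matDeriv A q u * B q + A q * matDeriv B q u := by
  ext r c
  exact dirDeriv_sum_mul (fun i => hA r i) (fun i => hB i c) q u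

theorem vecDeriv_mulVec [Fintype m] {A : Q → Matrix l m ℝ} {w : Q → m → ℝ}
    (hA : SmoothMatrix E A) (hw : SmoothVec E w) (q : Q) (u : TangentSpace 𝓘(ℝ, E) q) :
    vecDeriv (fun x => A x *ᵥ w x) q u = matDeriv A q u *ᵥ w q + A q *ᵥ vecDeriv w q u := by
  ext r
  exact dirDeriv_sum_mul (fun i => hA r i) (fun i => hw i) q u

theorem dirDeriv_dotProduct [Fintype m] {v w : Q → m → ℝ} (hv : SmoothVec E v) (hw : SmoothVec E w) (q : Q)
    (u : TangentSpace 𝓘(ℝ, E) q) :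
    dirDeriv (fun x => v x ⬝ᵥ w x) q u = vecDeriv v q u ⬝ᵥ w q + v q ⬝ᵥ vecDeriv w q u := by
  exact dirDeriv_sum_mul (fun i => hv i) (fun i => hw i) q u

theorem contMDiff_dotProduct [Fintype m] {v w : Q → m → ℝ} (hv : SmoothVec E v) (hw : SmoothVec E w) :
    ContMDiff 𝓘(ℝ, E) 𝓘(ℝ, ℝ) ∞ fun x => v x ⬝ᵥ w x := by
  simp only [dotProduct]
  exact contMDiff_sum_fun fun i _ => (hv i).mul (hw i)

theorem smoothMatrix_const (A : Matrix l n ℝ) : SmoothMatrix E fun _ : Q => A :=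
  fun _ _ => contMDiff_const

theorem matDeriv_const (A : Matrix l n ℝ) (q : Q) (u : TangentSpace 𝓘(ℝ, E) q) :
    matDeriv (fun _ => A) q u = 0 := by
  ext r c
  simp [matDeriv, dirDeriv_const]

theorem vecDeriv_const_mulVec [Fintype m] (A : Matrix l m ℝ) {w : Q → m → ℝ} (hw : SmoothVec E w) (q : Q)
    (u : TangentSpace 𝓘(ℝ, E) q) :
    vecDeriv (fun x => A *ᵥ w x) q u = A *ᵥ vecDeriv w q u := by
  rw [vecDeriv_mulVec (smoothMatrix_const A) hw, matDeriv_const, Matrix.zero_mulVec, zero_add]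

theorem SmoothVec.add {v w : Q → m → ℝ} (hv : SmoothVec E v) (hw : SmoothVec E w) :
    SmoothVec E fun x => v x + w x := fun r => (hv r).add (hw r)

theorem vecDeriv_add_fun {v w : Q → m → ℝ} (hv : SmoothVec E v) (hw : SmoothVec E w) (q : Q)
    (u : TangentSpace 𝓘(ℝ, E) q) :
    vecDeriv (fun x => v x + w x) q u = vecDeriv v q u + vecDeriv w q u :=
  funext fun r => dirDeriv_add_fun (hv r) (hw r) q u

theorem SmoothMatrix.matDeriv [IsManifold 𝓘(ℝ, E) ∞ Q] {A : Q → Matrix l n ℝ}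
    (hA : SmoothMatrix E A) {X : ∀ q : Q, TangentSpace 𝓘(ℝ, E) q}
    (hX : ContMDiff 𝓘(ℝ, E) 𝓘(ℝ, E).tangent ∞
      fun q => (⟨q, X q⟩ : TangentBundle 𝓘(ℝ, E) Q)) :
    SmoothMatrix E fun q => matDeriv A q (X q) :=
  fun r c => contMDiff_dirDeriv (hA r c) hX

theorem matDeriv_mlieBracket [CompleteSpace E] [IsManifold 𝓘(ℝ, E) ∞ Q]
    {A : Q → Matrix l n ℝ} (hA : SmoothMatrix E A) {X Y : ∀ q : Q, TangentSpace 𝓘(ℝ, E) q}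
    (hX : ContMDiff 𝓘(ℝ, E) 𝓘(ℝ, E).tangent ∞
      fun q => (⟨q, X q⟩ : TangentBundle 𝓘(ℝ, E) Q))
    (hY : ContMDiff 𝓘(ℝ, E) 𝓘(ℝ, E).tangent ∞
      fun q => (⟨q, Y q⟩ : TangentBundle 𝓘(ℝ, E) Q)) (q : Q) :
    matDeriv A q (VectorField.mlieBracket 𝓘(ℝ, E) X Y q) =
      matDeriv (fun x => matDeriv A x (Y x)) q (X q)
        - matDeriv (fun x => matDeriv A x (X x)) q (Y q) := by
  ext r c
  exact dirDeriv_mlieBracket (hA r c) hX hY q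

end

end DerivativeRules

/-! ### The Lie algebra of `SE(3)` -/

section Hat

/-- The matrix `[(ω ×), v; 0, 0]` of `se(3)` with coordinates `(ω, v)`. -/
def hat (v : Tw → ℝ) : Matrix (Fin 3 ⊕ Unit) (Fin 3 ⊕ Unit) ℝ :=
  Matrix.fromBlocks (skew fun i => v (Sum.inl i)) (Matrix.of fun i _ => v (Sum.inr i)) 0 0

theorem vee_hat (v : Tw → ℝ) : vee (hat v) = v := by
  funext r
  rcases r with r | r <;> fin_cases r <;> simp [vee, hat, skew]

/-- Identities between twists are proved below as identities between `4 × 4` matrices, where the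
adjoint action is conjugation and the cross product is a commutator. -/
theorem hat_injective : Function.Injective hat :=
  Function.LeftInverse.injective vee_hat

theorem hat_add (v w : Tw → ℝ) : hat (v + w) = hat v + hat w := by
  ext i j
  rcases i with i | i <;> rcases j with j | j <;> try fin_cases i <;> fin_cases j
  all_goals simp [hat, skew] <;> try ring

theorem hat_neg (v : Tw → ℝ) : hat (-v) = -hat v := by
  ext i j
  rcases i with i | i <;> rcases j with j | j <;> try fin_cases i <;> fin_cases j
  all_goals simp [hat, skew]

theorem hat_sub (v w : Tw → ℝ) : hat (v - w) = hat v - hat w := by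
  rw [sub_eq_add_neg, hat_add, hat_neg, sub_eq_add_neg]

theorem hat_crossMotion (v w : Tw → ℝ) :
    hat (crossMotion v *ᵥ w) = hat v * hat w - hat w * hat v := by
  ext i j
  rcases i with i | i <;> rcases j with j | j <;> try fin_cases i <;> try fin_cases j
  all_goals
    simp [hat, skew, crossMotion, Matrix.mul_apply, Matrix.mulVec, dotProduct, Fin.sum_univ_three] <;> try ring

theorem crossMotion_antisymm (v w : Tw → ℝ) : crossMotion v *ᵥ w = -(crossMotion w *ᵥ v) := by
  apply hat_injective
  rw [hat_neg, hat_crossMotion, hat_crossMotion, neg_sub]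

/-- The bilinear form of the left side is the triple product `det (R a, R w, R b)`, so the
determinant of `R` factors out. For rotations this says that the cross product is equivariant. -/
theorem transpose_mul_skew_mul (R : Matrix (Fin 3) (Fin 3) ℝ) (w : Fin 3 → ℝ) :
    Rᵀ * skew (R *ᵥ w) * R = R.det • skew w := by
  ext i j
  fin_cases i <;> fin_cases j <;>
    simp [skew, Matrix.mul_apply, Matrix.mulVec, dotProduct, Fin.sum_univ_three,
      Matrix.det_fin_three] <;> ring

namespace Pose

theorem transpose_rot_mul_rot (T : Pose) : T.rotᵀ * T.rot = 1 := by
  have h := T.rot_mem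
  rw [Matrix.mem_specialOrthogonalGroup_iff, Matrix.mem_orthogonalGroup_iff'] at h
  simpa [Matrix.star_eq_conjTranspose] using h.1

theorem rot_mul_transpose_rot (T : Pose) : T.rot * T.rotᵀ = 1 :=
  mul_eq_one_comm.mp T.transpose_rot_mul_rot

theorem rot_mul_skew (T : Pose) (w : Fin 3 → ℝ) : T.rot * skew w = skew (T.rot *ᵥ w) * T.rot := by
  have hd : T.rot.det = 1 := (Matrix.mem_specialOrthogonalGroup_iff.1 T.rot_mem).2
  have h := transpose_mul_skew_mul T.rot w
  rw [hd, one_smul] at h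
  rw [← h, ← mul_assoc, ← mul_assoc, T.rot_mul_transpose_rot, one_mul]

theorem toMatrix_mul_inv (T : Pose) : T.toMatrix * T.inv.toMatrix = 1 :=
  mul_eq_one_comm.mp T.toMatrix_inv_mul

/-- Stated without an inverse, so that it can be applied to `T` and to `T.inv` alike without
comparing `T.inv.inv` with `T`. -/
theorem hat_Ad_mul (T : Pose) (v : Tw → ℝ) :
    hat (T.Ad *ᵥ v) * T.toMatrix = T.toMatrix * hat v := by
  have h1 : (fun i => (T.Ad *ᵥ v) (Sum.inl i)) = T.rot *ᵥ fun i => v (Sum.inl i) := by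
    ext i; simp [Ad, Matrix.mulVec, dotProduct]
  have h2 : (fun i => (T.Ad *ᵥ v) (Sum.inr i)) =
      skew T.pos *ᵥ (T.rot *ᵥ fun i => v (Sum.inl i)) + T.rot *ᵥ fun i => v (Sum.inr i) := by
    ext i; simp [Ad, Matrix.mulVec, dotProduct, Matrix.mul_apply, Fin.sum_univ_three]
  have h3 : ∀ a b : Fin 3 → ℝ, skew a *ᵥ b + skew b *ᵥ a = 0 := by
    intro a b
    ext i; fin_cases i <;> simp [skew, dotProduct, Fin.sum_univ_three] <;> ring
  have h4 : hat (T.Ad *ᵥ v) = Matrix.fromBlocks (skew (T.rot *ᵥ fun i => v (Sum.inl i)))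
      (Matrix.of fun i _ => (skew T.pos *ᵥ (T.rot *ᵥ fun i => v (Sum.inl i))
        + T.rot *ᵥ fun i => v (Sum.inr i)) i) 0 0 := by
    rw [hat, h1, ← h2]
  rw [h4, toMatrix, hat, Matrix.fromBlocks_multiply, Matrix.fromBlocks_multiply]
  congr 1
  · simp [T.rot_mul_skew]
  · ext i j
    have := congrFun (h3 T.pos (T.rot *ᵥ fun i => v (Sum.inl i))) i
    simp [Matrix.mul_apply, Matrix.mulVec, dotProduct] at this ⊢
    linarith
  · simp
  · simp

theorem hat_Ad (T : Pose) (v : Tw → ℝ) :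
    hat (T.Ad *ᵥ v) = T.toMatrix * hat v * T.inv.toMatrix := by
  rw [← hat_Ad_mul, mul_assoc, toMatrix_mul_inv, mul_one]

theorem hat_Ad_inv (T : Pose) (v : Tw → ℝ) :
    hat (T.inv.Ad *ᵥ v) = T.inv.toMatrix * hat v * T.toMatrix := by
  have h := hat_Ad_mul T.inv v
  rw [← h, mul_assoc, toMatrix_inv_mul, mul_one]

theorem Ad_mul (T S : Pose) : (T.mul S).Ad = T.Ad * S.Ad := by
  refine Matrix.ext_of_mulVec_single fun j => hat_injective ?_
  have h := hat_Ad_mul (T.mul S) (Pi.single j 1)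
  rw [← Matrix.mulVec_mulVec, hat_Ad T, hat_Ad S]
  have h2 : (T.mul S).toMatrix * (S.inv.toMatrix * T.inv.toMatrix) = 1 := by
    rw [toMatrix_mul, mul_assoc, ← mul_assoc S.toMatrix, toMatrix_mul_inv, one_mul,
      toMatrix_mul_inv]
  calc _ = hat ((T.mul S).Ad *ᵥ Pi.single j 1)
        * ((T.mul S).toMatrix * (S.inv.toMatrix * T.inv.toMatrix)) := by rw [h2, mul_one]
    _ = _ := by rw [← mul_assoc, h, toMatrix_mul]; simp only [mul_assoc]

theorem Ad_inv_mul_Ad (T : Pose) : T.inv.Ad * T.Ad = 1 := by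
  refine Matrix.ext_of_mulVec_single fun j => hat_injective ?_
  rw [← Matrix.mulVec_mulVec, hat_Ad_inv, hat_Ad, Matrix.one_mulVec]
  simp only [mul_assoc, toMatrix_inv_mul, mul_one]
  rw [← mul_assoc, toMatrix_inv_mul, one_mul]

theorem Ad_mul_Ad_inv (T : Pose) : T.Ad * T.inv.Ad = 1 :=
  mul_eq_one_comm.mp T.Ad_inv_mul_Ad

theorem Ad_inv_mul_self (T : Pose) : (T.inv.mul T).Ad = 1 := by
  rw [Ad_mul, Ad_inv_mul_Ad]

end Pose

end Hat

/-! ### Body twists of smooth poses. -/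

section PoseCalculus

variable {E : Type*} [NormedAddCommGroup E] [NormedSpace ℝ E]
  {Q : Type*} [TopologicalSpace Q] [ChartedSpace E Q]

theorem SmoothPose.smoothMatrix {T : Q → Pose} (hT : SmoothPose E T) :
    SmoothMatrix E fun q => (T q).toMatrix := hT

theorem SmoothPose.rot {T : Q → Pose} (hT : SmoothPose E T) :
    SmoothMatrix E fun q => (T q).rot := fun r c => hT (Sum.inl r) (Sum.inl c)

theorem SmoothPose.pos {T : Q → Pose} (hT : SmoothPose E T) :
    SmoothVec E fun q => (T q).pos := fun r => hT (Sum.inl r) (Sum.inr ())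

theorem smoothPose_of_rot_pos {T : Q → Pose} (hR : SmoothMatrix E fun q => (T q).rot)
    (hp : SmoothVec E fun q => (T q).pos) : SmoothPose E T := by
  intro r c
  rcases r with r | r <;> rcases c with c | c
  · exact hR r c
  · exact hp r
  · exact contMDiff_const
  · exact contMDiff_const

theorem SmoothPose.mul {T S : Q → Pose} (hT : SmoothPose E T) (hS : SmoothPose E S) :
    SmoothPose E fun q => (T q).mul (S q) :=
  smoothPose_of_rot_pos (hT.rot.mul hS.rot) ((hT.rot.mulVec hS.pos).add hT.pos)

theorem SmoothMatrix.transpose {m n : Type*} {A : Q → Matrix m n ℝ} (hA : SmoothMatrix E A) :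
    SmoothMatrix E fun q => (A q)ᵀ := fun r c => hA c r

theorem matDeriv_transpose {m n : Type*} (A : Q → Matrix m n ℝ) (q : Q)
    (u : TangentSpace 𝓘(ℝ, E) q) :
    matDeriv (fun x => (A x)ᵀ) q u = (matDeriv A q u)ᵀ := rfl

theorem SmoothPose.inv {T : Q → Pose} (hT : SmoothPose E T) :
    SmoothPose E fun q => (T q).inv :=
  smoothPose_of_rot_pos hT.rot.transpose fun r => (hT.rot.transpose.mulVec hT.pos r).neg

/-- `vee` reads only some of the entries, so `T⁻¹ dT` must be shown to lie in `se(3)`: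
differentiating `Rᵀ R = 1` makes `Rᵀ dR` antisymmetric, and the last row of `T` is constant. -/
theorem hat_bodyTwist {T : Q → Pose} (hT : SmoothPose E T) (q : Q)
    (u : TangentSpace 𝓘(ℝ, E) q) :
    hat (bodyTwist T q u) = (T q).inv.toMatrix * matDeriv (fun x => (T x).toMatrix) q u := by
  have hR : (matDeriv (fun x => (T x).rot) q u)ᵀ * (T q).rot
      + (T q).rotᵀ * matDeriv (fun x => (T x).rot) q u = 0 := by
    rw [← matDeriv_transpose, ← matDeriv_mul hT.rot.transpose hT.rot]
    simp only [Pose.transpose_rot_mul_rot, matDeriv_const]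
  have hd : matDeriv (fun x => (T x).toMatrix) q u = Matrix.fromBlocks
      (matDeriv (fun x => (T x).rot) q u)
      (Matrix.of fun i _ => vecDeriv (fun x => (T x).pos) q u i) 0 0 := by
    ext r c
    rcases r with r | r <;> rcases c with c | c
    · rfl
    · rfl
    · exact dirDeriv_const _ _ _
    · exact dirDeriv_const _ _ _
  have hb : bodyTwist T q u = vee ((T q).inv.toMatrix * matDeriv (fun x => (T x).toMatrix) q u) :=
    rfl
  have hB : ((T q).rotᵀ * matDeriv (fun x => (T x).rot) q u)ᵀ =
      -((T q).rotᵀ * matDeriv (fun x => (T x).rot) q u) := by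
    rw [Matrix.transpose_mul, Matrix.transpose_transpose]
    exact eq_neg_of_add_eq_zero_left hR
  rw [hb, hd, Pose.inv, Pose.toMatrix, Matrix.fromBlocks_multiply]
  simp only [mul_zero, add_zero]
  generalize (T q).rotᵀ * matDeriv (fun x => (T x).rot) q u = B at hB
  generalize (T q).rotᵀ * (Matrix.of fun i _ => vecDeriv (fun x => (T x).pos) q u i :
    Matrix (Fin 3) Unit ℝ) = p
  have hB' : ∀ i j, B j i = -B i j := fun i j => congrFun (congrFun hB i) j
  have h0 := hB' 0 0
  have h1 := hB' 1 1
  have h2 := hB' 2 2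
  have h01 := hB' 0 1
  have h02 := hB' 0 2
  have h12 := hB' 1 2
  ext r c
  rcases r with r | r <;> rcases c with c | c <;> try fin_cases r <;> try fin_cases c
  all_goals simp [hat, vee, skew] <;> linarith

theorem toMatrix_mul_hat_bodyTwist {T : Q → Pose} (hT : SmoothPose E T) (q : Q)
    (u : TangentSpace 𝓘(ℝ, E) q) :
    (T q).toMatrix * hat (bodyTwist T q u) = matDeriv (fun x => (T x).toMatrix) q u := by
  rw [hat_bodyTwist hT, ← mul_assoc, Pose.toMatrix_mul_inv, one_mul]

theorem vee_add (A B : Matrix (Fin 3 ⊕ Unit) (Fin 3 ⊕ Unit) ℝ) :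
    vee (A + B) = vee A + vee B := by
  funext r
  rcases r with r | r <;> fin_cases r <;> simp [vee]

theorem vee_smul (a : ℝ) (A : Matrix (Fin 3 ⊕ Unit) (Fin 3 ⊕ Unit) ℝ) :
    vee (a • A) = a • vee A := by
  funext r
  rcases r with r | r <;> fin_cases r <;> simp [vee]

/-- The body twist as a linear function of the configuration velocity. -/
def bodyTwistLinear (T : Q → Pose) (q : Q) : TangentSpace 𝓘(ℝ, E) q →ₗ[ℝ] Tw → ℝ where
  toFun := bodyTwist T q
  map_add' u w := by
    have h : (Matrix.of fun r c => dirDeriv (fun x => (T x).toMatrix r c) q (u + w)) =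
        (Matrix.of fun r c => dirDeriv (fun x => (T x).toMatrix r c) q u)
          + Matrix.of fun r c => dirDeriv (fun x => (T x).toMatrix r c) q w := by
      ext r c
      exact dirDeriv_add _ _ _ _
    rw [bodyTwist, h, mul_add, vee_add]
    rfl
  map_smul' a u := by
    have h : (Matrix.of fun r c => dirDeriv (fun x => (T x).toMatrix r c) q (a • u)) =
        a • Matrix.of fun r c => dirDeriv (fun x => (T x).toMatrix r c) q u := by
      ext r c
      exact dirDeriv_smul _ _ _ _
    rw [bodyTwist, h, Matrix.mul_smul, vee_smul]
    rfl

theorem bodyTwist_sum_smul {ι : Type*} (s : Finset ι) (T : Q → Pose) (q : Q) (a : ι → ℝ)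
    (u : ι → TangentSpace 𝓘(ℝ, E) q) :
    bodyTwist T q (∑ i ∈ s, a i • u i) = ∑ i ∈ s, a i • bodyTwist T q (u i) := by
  have h := map_sum (bodyTwistLinear T q) (fun i => a i • u i) s
  simp only [map_smul] at h
  exact h

theorem smoothVec_bodyTwist [IsManifold 𝓘(ℝ, E) ∞ Q] {T : Q → Pose} (hT : SmoothPose E T)
    {X : ∀ q : Q, TangentSpace 𝓘(ℝ, E) q}
    (hX : ContMDiff 𝓘(ℝ, E) 𝓘(ℝ, E).tangent ∞
      fun q => (⟨q, X q⟩ : TangentBundle 𝓘(ℝ, E) Q)) :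
    SmoothVec E fun q => bodyTwist T q (X q) := by
  have h := hT.inv.smoothMatrix.mul (hT.smoothMatrix.matDeriv hX)
  intro r
  rcases r with r | r
  · fin_cases r
    · exact h (Sum.inl 2) (Sum.inl 1)
    · exact h (Sum.inl 0) (Sum.inl 2)
    · exact h (Sum.inl 1) (Sum.inl 0)
  · exact h (Sum.inl r) (Sum.inr ())

/-- Product rule: `(T S)⁻¹ d(T S) = S⁻¹ (T⁻¹ dT) S + S⁻¹ dS`, and conjugation by `S⁻¹` is the
adjoint action. -/
theorem bodyTwist_mul {T S : Q → Pose} (hT : SmoothPose E T) (hS : SmoothPose E S) (q : Q)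
    (u : TangentSpace 𝓘(ℝ, E) q) :
    bodyTwist (fun x => (T x).mul (S x)) q u =
      (S q).inv.Ad *ᵥ bodyTwist T q u + bodyTwist S q u := by
  apply hat_injective
  have h1 := toMatrix_mul_hat_bodyTwist (hT.mul hS) q u
  have h2 : matDeriv (fun x => ((T x).mul (S x)).toMatrix) q u =
      (T q).toMatrix * hat (bodyTwist T q u) * (S q).toMatrix
        + (T q).toMatrix * ((S q).toMatrix * hat (bodyTwist S q u)) := by
    simp only [Pose.toMatrix_mul]
    rw [matDeriv_mul hT.smoothMatrix hS.smoothMatrix, toMatrix_mul_hat_bodyTwist hT,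
      toMatrix_mul_hat_bodyTwist hS]
  have h3 : ((T q).mul (S q)).toMatrix *
      hat ((S q).inv.Ad *ᵥ bodyTwist T q u + bodyTwist S q u) =
      (T q).toMatrix * hat (bodyTwist T q u) * (S q).toMatrix
        + (T q).toMatrix * ((S q).toMatrix * hat (bodyTwist S q u)) := by
    rw [hat_add, mul_add, Pose.hat_Ad_inv, Pose.toMatrix_mul]
    congr 1
    · simp only [← mul_assoc]
      rw [mul_assoc (T q).toMatrix, Pose.toMatrix_mul_inv, mul_one]
    · rw [mul_assoc]
  have h4 := congrArg (fun M => ((T q).mul (S q)).inv.toMatrix * M) (h1.trans (h2.trans h3.symm))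
  simpa only [← mul_assoc, Pose.toMatrix_inv_mul, one_mul] using h4

theorem SmoothMatrix.skew {w : Q → Fin 3 → ℝ} (hw : SmoothVec E w) :
    SmoothMatrix E fun q => skew (w q) := by
  intro r c
  fin_cases r <;> fin_cases c
  · exact contMDiff_const
  · exact (hw 2).neg
  · exact hw 1
  · exact hw 2
  · exact contMDiff_const
  · exact (hw 0).neg
  · exact (hw 1).neg
  · exact hw 0
  · exact contMDiff_const

theorem SmoothPose.Ad {T : Q → Pose} (hT : SmoothPose E T) :
    SmoothMatrix E fun q => (T q).Ad := by
  intro r c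
  rcases r with r | r <;> rcases c with c | c
  · exact hT.rot r c
  · exact contMDiff_const
  · exact (SmoothMatrix.skew hT.pos).mul hT.rot r c
  · exact hT.rot r c

theorem SmoothMatrix.hat {w : Q → Tw → ℝ} (hw : SmoothVec E w) :
    SmoothMatrix E fun q => hat (w q) := by
  intro r c
  rcases r with r | r <;> rcases c with c | c
  · exact SmoothMatrix.skew (w := fun q i => w q (Sum.inl i)) (fun i => hw (Sum.inl i)) r c
  · exact hw (Sum.inr r)
  · exact contMDiff_const
  · exact contMDiff_const

theorem matDeriv_hat (w : Q → Tw → ℝ) (q : Q) (u : TangentSpace 𝓘(ℝ, E) q) :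
    matDeriv (fun x => hat (w x)) q u = hat (vecDeriv w q u) := by
  ext r c
  rcases r with r | r <;> rcases c with c | c
  · fin_cases r <;> fin_cases c <;>
      first
      | rfl
      | exact dirDeriv_const 0 q u
      | exact dirDeriv_neg_fun _ q u
  · rfl
  · exact dirDeriv_const 0 q u
  · exact dirDeriv_const 0 q u

/-- Differentiate `hat (Ad_T v) T = T (hat v)`, whose right side varies only through `T`. This
produces the term `(v ×) Φ` in `Φ̇`: it is the price of differentiating in a moving frame. -/
theorem matDeriv_Ad_mulVec {T : Q → Pose} (hT : SmoothPose E T) (v : Tw → ℝ) (q : Q)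
    (u : TangentSpace 𝓘(ℝ, E) q) :
    matDeriv (fun x => (T x).Ad) q u *ᵥ v = (T q).Ad *ᵥ (crossMotion (bodyTwist T q u) *ᵥ v) := by
  have hv : SmoothVec E fun _ : Q => v := fun _ => contMDiff_const
  have h1 : matDeriv (fun x => (T x).Ad) q u *ᵥ v = vecDeriv (fun x => (T x).Ad *ᵥ v) q u := by
    have h0 : vecDeriv (fun _ : Q => v) q u = 0 := funext fun _ => dirDeriv_const _ _ _
    rw [vecDeriv_mulVec hT.Ad hv, h0, Matrix.mulVec_zero, add_zero]
  have h2 : matDeriv (fun x => hat ((T x).Ad *ᵥ v) * (T x).toMatrix) q u =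
      matDeriv (fun x => (T x).toMatrix * hat v) q u := by
    simp only [Pose.hat_Ad_mul]
  rw [matDeriv_mul (SmoothMatrix.hat (hT.Ad.mulVec hv)) hT.smoothMatrix,
    matDeriv_mul hT.smoothMatrix (smoothMatrix_const _), matDeriv_const, mul_zero, add_zero,
    matDeriv_hat, ← toMatrix_mul_hat_bodyTwist hT, ← mul_assoc, Pose.hat_Ad_mul] at h2
  have h3 := Pose.hat_Ad_mul (T q) (crossMotion (bodyTwist T q u) *ᵥ v)
  rw [hat_crossMotion, mul_sub, ← mul_assoc, ← mul_assoc] at h3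
  have h4 := h3.trans (eq_sub_of_add_eq h2).symm
  have h5 := congrArg (fun M => M * (T q).inv.toMatrix) h4
  simp only [mul_assoc, Pose.toMatrix_mul_inv, mul_one] at h5
  rw [h1]
  exact (hat_injective h5).symm

/-- The Maurer–Cartan equation for body twists. -/
theorem bodyTwist_mlieBracket [CompleteSpace E] [IsManifold 𝓘(ℝ, E) ∞ Q] {T : Q → Pose}
    (hT : SmoothPose E T) {X Y : ∀ q : Q, TangentSpace 𝓘(ℝ, E) q}
    (hX : ContMDiff 𝓘(ℝ, E) 𝓘(ℝ, E).tangent ∞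
      fun q => (⟨q, X q⟩ : TangentBundle 𝓘(ℝ, E) Q))
    (hY : ContMDiff 𝓘(ℝ, E) 𝓘(ℝ, E).tangent ∞
      fun q => (⟨q, Y q⟩ : TangentBundle 𝓘(ℝ, E) Q)) (q : Q) :
    bodyTwist T q (VectorField.mlieBracket 𝓘(ℝ, E) X Y q) =
      vecDeriv (fun x => bodyTwist T x (Y x)) q (X q)
        - vecDeriv (fun x => bodyTwist T x (X x)) q (Y q)
        + crossMotion (bodyTwist T q (X q)) *ᵥ bodyTwist T q (Y q) := by
  -- The second derivative of `T` is `T` times a product of two twists plus a derivative of a twist;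
  -- the difference of the two orders is a commutator of matrices.
  have key : ∀ {Z W : ∀ q : Q, TangentSpace 𝓘(ℝ, E) q},
      (ContMDiff 𝓘(ℝ, E) 𝓘(ℝ, E).tangent ∞
        fun q => (⟨q, W q⟩ : TangentBundle 𝓘(ℝ, E) Q)) →
      matDeriv (fun x => matDeriv (fun y => (T y).toMatrix) x (W x)) q (Z q) =
        (T q).toMatrix * (hat (bodyTwist T q (Z q)) * hat (bodyTwist T q (W q))
          + hat (vecDeriv (fun x => bodyTwist T x (W x)) q (Z q))) := by
    intro Z W hW
    simp only [← toMatrix_mul_hat_bodyTwist hT]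
    rw [matDeriv_mul hT.smoothMatrix (SmoothMatrix.hat (smoothVec_bodyTwist hT hW)),
      ← toMatrix_mul_hat_bodyTwist hT, matDeriv_hat, mul_add, mul_assoc]
  apply hat_injective
  have h := matDeriv_mlieBracket hT.smoothMatrix hX hY q
  rw [key hX, key hY, ← toMatrix_mul_hat_bodyTwist hT, ← mul_sub] at h
  have h2 := congrArg (fun M => (T q).inv.toMatrix * M) h
  simp only [← mul_assoc, Pose.toMatrix_inv_mul, one_mul] at h2
  rw [h2, hat_add, hat_sub, hat_crossMotion]
  abel

end PoseCalculus

theorem Pose.mul_inv_mul (T S : Pose) : T.mul (T.inv.mul S) = S := by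
  have h : T.rot *ᵥ (T.rotᵀ *ᵥ S.pos + -(T.rotᵀ *ᵥ T.pos)) + T.pos = S.pos := by
    rw [Matrix.mulVec_add, Matrix.mulVec_neg, Matrix.mulVec_mulVec, Matrix.mulVec_mulVec,
      T.rot_mul_transpose_rot, Matrix.one_mulVec, Matrix.one_mulVec, neg_add_cancel_right]
  have h' : T.rot * (T.rotᵀ * S.rot) = S.rot := by
    rw [← mul_assoc, T.rot_mul_transpose_rot, one_mul]
  cases S
  simp only [mul, inv, Pose.mk.injEq]
  exact ⟨h', h⟩

theorem Pose.Ad_inv_inv_mul (T S : Pose) : (T.inv.mul S).inv.Ad = (S.inv.mul T).Ad := by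
  have h1 : (S.inv.mul T).Ad * (T.inv.mul S).Ad = 1 := by
    rw [Pose.Ad_mul, Pose.Ad_mul, mul_assoc, ← mul_assoc T.Ad, Pose.Ad_mul_Ad_inv, one_mul,
      Pose.Ad_inv_mul_Ad]
  calc _ = (S.inv.mul T).Ad * (T.inv.mul S).Ad * (T.inv.mul S).inv.Ad := by rw [h1, one_mul]
    _ = _ := by rw [mul_assoc, Pose.Ad_mul_Ad_inv, mul_one]

/-! ### Paths of parent bodies. -/

namespace ClusterTree

variable {N : ℕ} (t : ClusterTree N)

theorem bodyParent_lt {b c : t.Body} (h : t.bodyParent b = some c) : c.1 < b.1 := by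
  have := t.bodyParent_cluster b
  rw [h] at this
  exact t.parent_lt this.symm

theorem exists_bodyParent {i p : Fin N} (h : t.parent i = some p) (b : Fin (t.bodies i)) :
    ∃ c, t.bodyParent ⟨i, b⟩ = some ⟨p, c⟩ := by
  have h1 := t.bodyParent_cluster ⟨i, b⟩
  rw [h] at h1
  obtain ⟨⟨p', c⟩, h2, h3⟩ := Option.map_eq_some_iff.1 h1
  obtain rfl : p' = p := h3
  exact ⟨c, h2⟩

theorem bodyParent_eq_none {i : Fin N} (h : t.parent i = none) (b : Fin (t.bodies i)) :
    t.bodyParent ⟨i, b⟩ = none := by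
  have h1 := t.bodyParent_cluster ⟨i, b⟩
  rw [h] at h1
  exact Option.map_eq_none_iff.1 h1

theorem precedes_iff {c b : t.Body} :
    t.Precedes c b ↔ c = b ∨ ∃ p, t.bodyParent b = some p ∧ t.Precedes c p := by
  unfold Precedes
  rw [Relation.ReflTransGen.cases_head_iff, eq_comm]

theorem Precedes.eq_or_lt {c b : t.Body} (h : t.Precedes c b) : c = b ∨ c.1 < b.1 := by
  induction h with
  | refl => exact Or.inl rfl
  | tail _ h ih =>
    right
    rcases ih with rfl | ih
    · exact t.bodyParent_lt h
    · exact (t.bodyParent_lt h).trans ih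

theorem precedes_same_cluster {i : Fin N} {c b : Fin (t.bodies i)} :
    t.Precedes ⟨i, c⟩ ⟨i, b⟩ ↔ c = b := by
  constructor
  · intro h
    rcases Precedes.eq_or_lt t h with h | h
    · simpa using h
    · exact absurd h (lt_irrefl _)
  · rintro rfl
    exact Relation.ReflTransGen.refl

end ClusterTree

theorem relPose_of_none {Q : Type*} {N : ℕ} (t : ClusterTree N) (pose : t.Body → Q → Pose) {b : t.Body}
    (h : t.bodyParent b = none) : relPose t pose b = pose b := by
  funext q
  simp [relPose, h]

theorem relPose_of_some {Q : Type*} {N : ℕ} (t : ClusterTree N) (pose : t.Body → Q → Pose) {b c : t.Body}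
    (h : t.bodyParent b = some c) :
    relPose t pose b = fun q => (pose c q).inv.mul (pose b q) := by
  funext q
  simp [relPose, h]

/-! ### Propagation of twists and of their rates along the tree. -/

section Geometry

variable {E : Type*} [NormedAddCommGroup E] [NormedSpace ℝ E]
  {Q : Type*} [TopologicalSpace Q] [ChartedSpace E Q]

theorem vecDeriv_sum_smul {m ι : Type*} (s : Finset ι) (w : Q → m → ℝ) (q : Q) (a : ι → ℝ)
    (u : ι → TangentSpace 𝓘(ℝ, E) q) :
    vecDeriv w q (∑ i ∈ s, a i • u i) = ∑ i ∈ s, a i • vecDeriv w q (u i) := by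
  funext r
  simp only [vecDeriv, dirDeriv_sum, dirDeriv_smul, Finset.sum_apply, Pi.smul_apply, smul_eq_mul]

namespace MultibodySystem

variable [IsManifold 𝓘(ℝ, E) ∞ Q] {N : ℕ} {t : ClusterTree N} (S : MultibodySystem t E Q)

theorem relPose_smooth (b : t.Body) : SmoothPose E (relPose t S.pose b) := by
  rcases h : t.bodyParent b with _ | c
  · rw [relPose_of_none t S.pose h]
    exact S.pose_smooth b
  · rw [relPose_of_some t S.pose h]
    exact (S.pose_smooth c).inv.mul (S.pose_smooth b)

/-- The product rule `bodyTwist_mul` for `T_b = T_c (T_c⁻¹ T_b)`. -/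
theorem bodyTwist_of_some {b c : t.Body} (h : t.bodyParent b = some c) (q : Q)
    (u : TangentSpace 𝓘(ℝ, E) q) :
    bodyTwist (S.pose b) q u = ((S.pose b q).inv.mul (S.pose c q)).Ad *ᵥ bodyTwist (S.pose c) q u
      + bodyTwist (relPose t S.pose b) q u := by
  have h1 := bodyTwist_mul (S.pose_smooth c) (S.relPose_smooth b) q u
  have h2 : (fun x => (S.pose c x).mul (relPose t S.pose b x)) = S.pose b := by
    rw [relPose_of_some t S.pose h]
    exact funext fun x => Pose.mul_inv_mul _ _
  rw [h2] at h1
  rw [h1, relPose_of_some t S.pose h, Pose.Ad_inv_inv_mul]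

/-- The block of the transform matrix for a pair of clusters. -/
def block (q : Q) (i k : Fin N) : Matrix (t.Row i) (t.Row k) ℝ :=
  (S.transform q).submatrix (Sigma.mk i) (Sigma.mk k)

open Classical in
theorem block_apply (q : Q) {i k : Fin N} (r s : Tw) (b : Fin (t.bodies i))
    (c : Fin (t.bodies k)) :
    S.block q i k (r, b) (s, c) = if t.Precedes ⟨k, c⟩ ⟨i, b⟩ then
      ((S.pose ⟨i, b⟩ q).inv.mul (S.pose ⟨k, c⟩ q)).Ad r s else 0 := rfl

theorem block_of_lt (q : Q) {i k : Fin N} (h : i < k) : S.block q i k = 0 := by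
  ext ⟨r, b⟩ ⟨s, c⟩
  rw [block_apply, if_neg]
  · rfl
  · intro h1
    rcases ClusterTree.Precedes.eq_or_lt t h1 with h2 | h2
    · exact h.ne' (congrArg Sigma.fst h2)
    · exact lt_asymm h h2

theorem block_self (q : Q) (i : Fin N) : S.block q i i = 1 := by
  classical
  ext ⟨r, b⟩ ⟨s, c⟩
  rw [block_apply, t.precedes_same_cluster]
  by_cases h : c = b
  · subst h
    rw [if_pos rfl, Pose.Ad_inv_mul_self]
    simp [Matrix.one_apply]
  · rw [if_neg h, Matrix.one_apply_ne]
    simp [Ne.symm h]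

theorem block_of_none {i : Fin N} (h : t.parent i = none) (q : Q) {k : Fin N} (hk : k ≠ i) :
    S.block q i k = 0 := by
  ext ⟨r, b⟩ ⟨s, c⟩
  rw [block_apply, Matrix.zero_apply, if_neg]
  rw [t.precedes_iff]
  rintro (h1 | ⟨p, h1, -⟩)
  · exact hk (congrArg Sigma.fst h1)
  · rw [t.bodyParent_eq_none h] at h1
    simp at h1

/-- In the parent cluster only the parent body precedes a given body, so each block row has a single
nonzero adjoint. -/
theorem block_parent_mulVec {i p : Fin N} (h : t.parent i = some p) (q : Q)
    (w : t.Row p → ℝ) {b : Fin (t.bodies i)} {c : Fin (t.bodies p)}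
    (hc : t.bodyParent ⟨i, b⟩ = some ⟨p, c⟩) (r : Tw) :
    (S.block q i p *ᵥ w) (r, b) =
      (((S.pose ⟨i, b⟩ q).inv.mul (S.pose ⟨p, c⟩ q)).Ad *ᵥ fun s => w (s, c)) r := by
  have hp : ∀ d, t.Precedes ⟨p, d⟩ ⟨i, b⟩ ↔ d = c := by
    intro d
    rw [t.precedes_iff]
    constructor
    · rintro (h1 | ⟨e, h1, h2⟩)
      · exact absurd (congrArg Sigma.fst h1) (t.parent_lt h).ne
      · rw [hc] at h1
        obtain rfl := Option.some.inj h1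
        exact t.precedes_same_cluster.1 h2
    · rintro rfl
      exact Or.inr ⟨_, hc, Relation.ReflTransGen.refl⟩
  simp only [Matrix.mulVec, dotProduct, block_apply, hp, Fintype.sum_prod_type, ite_mul, zero_mul, Finset.sum_ite_eq',
    Finset.mem_univ, if_true]

/-- Every path from a body to another cluster passes through its parent body, and adjoints compose
along the path. -/
theorem block_of_some {i p : Fin N} (h : t.parent i = some p) (q : Q) {k : Fin N} (hk : k ≠ i) :
    S.block q i k = S.block q i p * S.block q p k := by
  refine Matrix.ext_of_mulVec_single fun ⟨s, d⟩ => ?_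
  rw [← Matrix.mulVec_mulVec]
  ext ⟨r, b⟩
  obtain ⟨c, hc⟩ := t.exists_bodyParent h b
  rw [S.block_parent_mulVec h q _ hc]
  simp only [Matrix.mulVec_single_one, Matrix.col_apply, block_apply]
  have hp : t.Precedes ⟨k, d⟩ ⟨i, b⟩ ↔ t.Precedes ⟨k, d⟩ ⟨p, c⟩ := by
    rw [t.precedes_iff]
    constructor
    · rintro (h1 | ⟨e, h1, h2⟩)
      · exact absurd (congrArg Sigma.fst h1) hk
      · rw [hc] at h1
        obtain rfl := Option.some.inj h1
        exact h2
    · exact fun h1 => Or.inr ⟨_, hc, h1⟩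
  by_cases h1 : t.Precedes ⟨k, d⟩ ⟨p, c⟩
  · simp only [if_pos h1, if_pos (hp.2 h1)]
    have h2 : ((S.pose ⟨i, b⟩ q).inv.mul (S.pose ⟨k, d⟩ q)).Ad =
        ((S.pose ⟨i, b⟩ q).inv.mul (S.pose ⟨p, c⟩ q)).Ad
          * ((S.pose ⟨p, c⟩ q).inv.mul (S.pose ⟨k, d⟩ q)).Ad := by
      simp only [Pose.Ad_mul]
      rw [mul_assoc, ← mul_assoc (S.pose ⟨p, c⟩ q).Ad, Pose.Ad_mul_Ad_inv, one_mul]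
    rw [h2, Matrix.mul_apply]
    rfl
  · simp [if_neg h1, if_neg (mt hp.1 h1), Matrix.mulVec, dotProduct]

theorem transform_mulVec (q : Q) (w : t.Rows → ℝ) (i : Fin N) (r : t.Row i) :
    (S.transform q *ᵥ w) ⟨i, r⟩ = ∑ k, (S.block q i k *ᵥ fun s => w ⟨k, s⟩) r := by
  simp only [Matrix.mulVec, dotProduct, Fintype.sum_sigma]
  rfl

/-- Quantities that are propagated along the tree by the transforms to the parent clusters are
given by the full transform matrix. -/
theorem transform_mulVec_eq (q : Q) {y w : t.Rows → ℝ}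
    (hnone : ∀ i, t.parent i = none → ∀ r, y ⟨i, r⟩ = w ⟨i, r⟩)
    (hsome : ∀ i p, t.parent i = some p → ∀ r,
      y ⟨i, r⟩ = (S.block q i p *ᵥ fun s => y ⟨p, s⟩) r + w ⟨i, r⟩) :
    S.transform q *ᵥ w = y := by
  suffices h : ∀ i r, (S.transform q *ᵥ w) ⟨i, r⟩ = y ⟨i, r⟩ by
    funext ⟨i, r⟩
    exact h i r
  intro i
  induction i using WellFoundedLT.induction with
  | ind i ih =>
    intro r
    rw [transform_mulVec, ← Finset.add_sum_erase _ _ (Finset.mem_univ i), block_self,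
      Matrix.one_mulVec]
    rcases h : t.parent i with _ | p
    · rw [hnone i h, Finset.sum_eq_zero, add_zero]
      intro k hk
      rw [S.block_of_none h q (Finset.ne_of_mem_erase hk), Matrix.zero_mulVec]
      rfl
    · rw [hsome i p h, add_comm]
      congr 1
      -- The index `i` may be left out of the expansion at `p`, since `p < i` makes the block `(p,
      -- i)` zero. The two sums then run over the same index set.
      have h1 : (fun s => y ⟨p, s⟩) = ∑ k ∈ Finset.univ.erase i,
          S.block q p k *ᵥ fun s => w ⟨k, s⟩ := by
        funext s
        rw [← ih p (t.parent_lt h) s, transform_mulVec,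
          ← Finset.add_sum_erase _ _ (Finset.mem_univ i), S.block_of_lt q (t.parent_lt h),
          Matrix.zero_mulVec, Finset.sum_apply]
        exact zero_add _
      rw [h1, Matrix.mulVec_sum, Finset.sum_apply]
      refine Finset.sum_congr rfl fun k hk => ?_
      rw [S.block_of_some h q (Finset.ne_of_mem_erase hk), Matrix.mulVec_mulVec]

/-- The twist of a body relative to its parent body for a unit speed. -/
def relTwist (b : t.Body) (k : t.Speeds) (q : Q) : Tw → ℝ :=
  bodyTwist (relPose t S.pose b) q (S.frame k q)

theorem smoothVec_relTwist (b : t.Body) (k : t.Speeds) : SmoothVec E (S.relTwist b k) :=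
  smoothVec_bodyTwist (S.relPose_smooth b) (S.frame_smooth k)

theorem relTwist_of_ne {b : t.Body} {k : t.Speeds} (h : b.1 ≠ k.1) : S.relTwist b k = 0 :=
  funext fun q => S.joint_local k b h q

/-- Off the diagonal blocks, `joint_local` makes the relative twists vanish, so one formula covers
all entries of `Φ`. -/
theorem modes_apply (q : Q) (i : Fin N) (r : Tw) (b : Fin (t.bodies i)) (k : t.Speeds) :
    S.modes q ⟨i, (r, b)⟩ k = S.relTwist ⟨i, b⟩ k q r := by
  obtain ⟨j, a⟩ := k
  by_cases h : i = j
  · subst h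
    rw [modes, Matrix.blockDiagonal'_apply_eq]
    rfl
  · rw [modes, Matrix.blockDiagonal'_apply_ne _ _ _ h, S.relTwist_of_ne h]
    rfl

theorem bodyTwist_relPose_velocity (b : t.Body) (q : Q) (vbar : t.Speeds → ℝ) :
    bodyTwist (relPose t S.pose b) q (S.velocity q vbar) = ∑ k, vbar k • S.relTwist b k q :=
  bodyTwist_sum_smul _ _ _ _ _

theorem clusterTwist_of_none {i : Fin N} (h : t.parent i = none) (q : Q) (vbar : t.Speeds → ℝ)
    (r : t.Row i) :
    S.clusterTwist q vbar i r = (S.modes q *ᵥ vbar) ⟨i, r⟩ := by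
  obtain ⟨r, b⟩ := r
  have h1 := S.bodyTwist_relPose_velocity ⟨i, b⟩ q vbar
  rw [relPose_of_none t S.pose (t.bodyParent_eq_none h b)] at h1
  rw [clusterTwist, h1]
  simp [Matrix.mulVec, dotProduct, modes_apply, mul_comm]

theorem clusterTwist_of_some {i p : Fin N} (h : t.parent i = some p) (q : Q)
    (vbar : t.Speeds → ℝ) (r : t.Row i) :
    S.clusterTwist q vbar i r =
      (S.block q i p *ᵥ S.clusterTwist q vbar p) r + (S.modes q *ᵥ vbar) ⟨i, r⟩ := by
  obtain ⟨r, b⟩ := r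
  obtain ⟨c, hc⟩ := t.exists_bodyParent h b
  rw [S.block_parent_mulVec h q _ hc, clusterTwist, S.bodyTwist_of_some hc,
    bodyTwist_relPose_velocity]
  simp [Matrix.mulVec, dotProduct, modes_apply, mul_comm, clusterTwist]

theorem twists_eq (q : Q) (vbar : t.Speeds → ℝ) :
    S.twists q vbar = (S.transform q * S.modes q) *ᵥ vbar := by
  rw [← Matrix.mulVec_mulVec]
  exact (S.transform_mulVec_eq q (fun i h r => S.clusterTwist_of_none h q vbar r)
    fun i p h r => S.clusterTwist_of_some h q vbar r).symm

/-- The body twist for a unit speed. -/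
def frameTwist (b : t.Body) (k : t.Speeds) (q : Q) : Tw → ℝ :=
  bodyTwist (S.pose b) q (S.frame k q)

theorem smoothVec_frameTwist (b : t.Body) (k : t.Speeds) : SmoothVec E (S.frameTwist b k) :=
  smoothVec_bodyTwist (S.pose_smooth b) (S.frame_smooth k)

theorem velocity_single (q : Q) (k : t.Speeds) :
    S.velocity q (Pi.single k 1) = S.frame k q := by
  rw [velocity, Finset.sum_eq_single k]
  · simp
  · intro j _ hj
    simp [hj]
  · simp

/-- Evaluating `v = XΦ v̄` at a unit speed identifies the columns of `XΦ`. -/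
theorem transform_mul_modes_apply (q : Q) (i : Fin N) (r : Tw) (b : Fin (t.bodies i))
    (k : t.Speeds) :
    (S.transform q * S.modes q) ⟨i, (r, b)⟩ k = S.frameTwist ⟨i, b⟩ k q r := by
  have h := congrFun (S.twists_eq q (Pi.single k 1)) ⟨i, (r, b)⟩
  rw [Matrix.mulVec_single_one] at h
  rw [← Matrix.col_apply (S.transform q * S.modes q), ← h, twists, clusterTwist, velocity_single]
  rfl

theorem modesDot_apply (q : Q) (vbar : t.Speeds → ℝ) (i : Fin N) (r : Tw) (b : Fin (t.bodies i))
    (k : t.Speeds) :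
    S.modesDot q vbar ⟨i, (r, b)⟩ k =
      (crossMotion (bodyTwist (S.pose ⟨i, b⟩) q (S.velocity q vbar)) *ᵥ S.relTwist ⟨i, b⟩ k q) r
        + vecDeriv (S.relTwist ⟨i, b⟩ k) q (S.velocity q vbar) r := by
  rw [modesDot, Matrix.add_apply, Matrix.mul_apply, Fintype.sum_sigma, Finset.sum_eq_single i]
  · congr 1
    · simp only [Matrix.blockDiagonal'_apply_eq, clusterCross, Fintype.sum_prod_type,
        Matrix.blockDiagonal_apply, modes_apply, ite_mul, zero_mul, Finset.sum_ite_eq,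
        Finset.mem_univ, if_true, Matrix.mulVec, dotProduct]
      rfl
    · obtain ⟨j, a⟩ := k
      by_cases h : i = j
      · subst h
        rw [Matrix.blockDiagonal'_apply_eq]
        rfl
      · rw [Matrix.blockDiagonal'_apply_ne _ _ _ h, S.relTwist_of_ne h]
        exact (dirDeriv_const 0 q _).symm
  · intro j _ hj
    refine Finset.sum_eq_zero fun s _ => ?_
    rw [Matrix.blockDiagonal'_apply_ne _ _ _ hj.symm, zero_mul]
  · simp

/-- The inertial rate of change of the body twist for a unit speed. -/
def frameTwistRate (b : t.Body) (k : t.Speeds) (q : Q) (u : TangentSpace 𝓘(ℝ, E) q) : Tw → ℝ :=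
  crossMotion (bodyTwist (S.pose b) q u) *ᵥ S.frameTwist b k q + vecDeriv (S.frameTwist b k) q u

/-- In ground coordinates the twist recursion reads `Ad_b x_b = Ad_c x_c + Ad_b φ_b`. By
`matDeriv_Ad_mulVec` the derivative of each `Ad_T w` is `Ad_T` applied to the inertial rate of `w`,
so applying `Ad_b⁻¹` gives the same recursion for the rates. -/
theorem frameTwistRate_of_some {b c : t.Body} (h : t.bodyParent b = some c) (k : t.Speeds) (q : Q)
    (u : TangentSpace 𝓘(ℝ, E) q) :
    S.frameTwistRate b k q u =
      ((S.pose b q).inv.mul (S.pose c q)).Ad *ᵥ S.frameTwistRate c k q u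
        + (crossMotion (bodyTwist (S.pose b) q u) *ᵥ S.relTwist b k q
          + vecDeriv (S.relTwist b k) q u) := by
  have hrec : (fun x => (S.pose b x).Ad *ᵥ S.frameTwist b k x) = fun x =>
      (S.pose c x).Ad *ᵥ S.frameTwist c k x + (S.pose b x).Ad *ᵥ S.relTwist b k x := by
    funext x
    rw [frameTwist, S.bodyTwist_of_some h, Matrix.mulVec_add, Matrix.mulVec_mulVec, Pose.Ad_mul,
      ← mul_assoc, Pose.Ad_mul_Ad_inv, one_mul]
    rfl
  have hd : ∀ (b : t.Body) {w : Q → Tw → ℝ}, SmoothVec E w →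
      vecDeriv (fun x => (S.pose b x).Ad *ᵥ w x) q u =
        (S.pose b q).Ad *ᵥ (crossMotion (bodyTwist (S.pose b) q u) *ᵥ w q + vecDeriv w q u) := by
    intro b w hw
    rw [vecDeriv_mulVec (S.pose_smooth b).Ad hw, matDeriv_Ad_mulVec (S.pose_smooth b),
      Matrix.mulVec_add]
  have h1 := congrArg (fun f => vecDeriv f q u) hrec
  rw [hd b (S.smoothVec_frameTwist b k), vecDeriv_add_fun
    ((S.pose_smooth c).Ad.mulVec (S.smoothVec_frameTwist c k))
    ((S.pose_smooth b).Ad.mulVec (S.smoothVec_relTwist b k)),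
    hd c (S.smoothVec_frameTwist c k), hd b (S.smoothVec_relTwist b k)] at h1
  have h2 := congrArg (fun f => (S.pose b q).inv.Ad *ᵥ f) h1
  simp only [Matrix.mulVec_add (S.pose b q).inv.Ad ((S.pose c q).Ad *ᵥ _), Matrix.mulVec_mulVec _ _ (S.pose b q).Ad,
    Matrix.mulVec_mulVec _ (S.pose b q).inv.Ad, Pose.Ad_inv_mul_Ad, Matrix.one_mulVec] at h2
  rw [Pose.Ad_mul]
  exact h2

/-- The rates obey the recursion solved by `X`, with source `Φ̇`. At the roots the relative twist is
the full twist, so the two rates agree. -/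
theorem transform_mul_modesDot_apply (q : Q) (vbar : t.Speeds → ℝ) (i : Fin N) (r : Tw)
    (b : Fin (t.bodies i)) (k : t.Speeds) :
    (S.transform q * S.modesDot q vbar) ⟨i, (r, b)⟩ k =
      S.frameTwistRate ⟨i, b⟩ k q (S.velocity q vbar) r := by
  have h := S.transform_mulVec_eq q (w := fun r => S.modesDot q vbar r k)
    (y := fun r => S.frameTwistRate ⟨r.1, r.2.2⟩ k q (S.velocity q vbar) r.2.1) ?_ ?_
  · exact congrFun h ⟨i, (r, b)⟩
  · rintro i hi ⟨r, b⟩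
    rw [modesDot_apply]
    have h1 : S.relTwist ⟨i, b⟩ k = S.frameTwist ⟨i, b⟩ k := by
      funext x
      rw [relTwist, relPose_of_none t S.pose (t.bodyParent_eq_none hi b)]
      rfl
    rw [h1]
    rfl
  · rintro i p hi ⟨r, b⟩
    obtain ⟨c, hc⟩ := t.exists_bodyParent hi b
    rw [modesDot_apply, S.block_parent_mulVec hi q _ hc]
    exact congrFun (S.frameTwistRate_of_some hc k q _) r

end MultibodySystem

end Geometry

/-! ### Christoffel symbols and the factorisation of the Coriolis matrix. -/

theorem RigidBody.inertia_transpose (b : RigidBody) : b.inertiaᵀ = b.inertia := by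
  rw [inertia, Matrix.fromBlocks_transpose, b.rotInertia_symm.eq]
  simp

theorem dotProduct_mulVec_comm {m : Type*} [Fintype m] {A : Matrix m m ℝ} (hA : Aᵀ = A)
    (v w : m → ℝ) : v ⬝ᵥ A *ᵥ w = w ⬝ᵥ A *ᵥ v := by
  rw [Matrix.dotProduct_mulVec, ← Matrix.mulVec_transpose, hA, dotProduct_comm]

theorem dotProduct_mulVec_sum_smul {m n ι : Type*} [Fintype m] [Fintype n] (s : Finset ι)
    (v : m → ℝ) (A : Matrix m n ℝ) (a : ι → ℝ) (w : ι → n → ℝ) :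
    v ⬝ᵥ A *ᵥ ∑ j ∈ s, a j • w j = ∑ j ∈ s, a j * (v ⬝ᵥ A *ᵥ w j) := by
  simp only [Matrix.mulVec_sum, Matrix.mulVec_smul, dotProduct_sum, dotProduct_smul, smul_eq_mul]

theorem mul_mul_apply_eq_dotProduct {l l' m : Type*} [Fintype m] (A : Matrix m l ℝ)
    (M : Matrix m m ℝ) (B : Matrix m l' ℝ) (i : l) (k : l') :
    (Aᵀ * M * B) i k = (fun r => A r i) ⬝ᵥ M *ᵥ fun r => B r k := by
  rw [Matrix.mul_assoc, Matrix.mul_apply]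
  rfl

theorem dotProduct_crossForce_mulVec (a v f : Tw → ℝ) :
    a ⬝ᵥ crossForce v *ᵥ f = -((crossMotion v *ᵥ a) ⬝ᵥ f) := by
  rw [crossForce, Matrix.neg_mulVec, dotProduct_neg,
    Matrix.dotProduct_transpose_mulVec, dotProduct_comm]

/-- The force cross products are moved to the other argument by duality, which puts the factor in
the shape of the cross-product terms of `christoffel_eq`. -/
theorem dotProduct_bodyFactor_mulVec {I : Matrix Tw Tw ℝ} (hI : Iᵀ = I) (v a b : Tw → ℝ) :
    a ⬝ᵥ bodyFactor I v *ᵥ b =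
      (1 / 2) * (b ⬝ᵥ I *ᵥ (crossMotion a *ᵥ v) + (crossMotion a *ᵥ b) ⬝ᵥ I *ᵥ v
        - a ⬝ᵥ I *ᵥ (crossMotion v *ᵥ b)) := by
  rw [bodyFactor, Matrix.smul_mulVec, dotProduct_smul, Matrix.sub_mulVec, Matrix.add_mulVec,
    ← Matrix.mulVec_mulVec, ← Matrix.mulVec_mulVec, crossForceBar_mulVec, dotProduct_sub,
    dotProduct_add, dotProduct_crossForce_mulVec, dotProduct_crossForce_mulVec,
    crossMotion_antisymm v a, crossMotion_antisymm b a, neg_dotProduct, neg_dotProduct, neg_neg,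
    neg_neg, dotProduct_mulVec_comm hI (crossMotion a *ᵥ v), smul_eq_mul]

section Geometry

variable {E : Type*} [NormedAddCommGroup E] [NormedSpace ℝ E]
  {Q : Type*} [TopologicalSpace Q] [ChartedSpace E Q]

namespace MultibodySystem

variable [IsManifold 𝓘(ℝ, E) ∞ Q] {N : ℕ} {t : ClusterTree N} (S : MultibodySystem t E Q)

theorem metric_comm (q : Q) (u w : TangentSpace 𝓘(ℝ, E) q) : S.metric q u w = S.metric q w u :=
  Finset.sum_congr rfl fun b _ => dotProduct_mulVec_comm (S.body b).inertia_transpose _ _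

theorem dirDeriv_massMatrix (q : Q) (i j : t.Speeds) (u : TangentSpace 𝓘(ℝ, E) q) :
    dirDeriv (fun x => S.massMatrix x i j) q u =
      ∑ b, (vecDeriv (S.frameTwist b i) q u ⬝ᵥ (S.body b).inertia *ᵥ S.frameTwist b j q
        + S.frameTwist b i q ⬝ᵥ (S.body b).inertia *ᵥ vecDeriv (S.frameTwist b j) q u) := by
  have hs : ∀ b, SmoothVec E fun x => (S.body b).inertia *ᵥ S.frameTwist b j x := fun b =>
    (smoothMatrix_const _).mulVec (S.smoothVec_frameTwist b j)
  have h : (fun x => S.massMatrix x i j) =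
      fun x => ∑ b, S.frameTwist b i x ⬝ᵥ (S.body b).inertia *ᵥ S.frameTwist b j x := rfl
  rw [h, dirDeriv_sum_fun fun b _ => contMDiff_dotProduct (S.smoothVec_frameTwist b i) (hs b)]
  refine Finset.sum_congr rfl fun b _ => ?_
  rw [dirDeriv_dotProduct (S.smoothVec_frameTwist b i) (hs b),
    vecDeriv_const_mulVec _ (S.smoothVec_frameTwist b j)]

/-- The product rule gives six derivatives of twists, and Maurer–Cartan for the brackets six more.
By symmetry of the inertia they cancel in pairs, except that `x_iᵀ I (L_j x_k)` occurs twice, which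
absorbs the factor `1 / 2`. The cross products come from the brackets alone. -/
theorem christoffel_eq [CompleteSpace E] (q : Q) (i j k : t.Speeds) :
    S.christoffel q i j k =
      ∑ b, (S.frameTwist b i q ⬝ᵥ (S.body b).inertia *ᵥ
          vecDeriv (S.frameTwist b k) q (S.frame j q)
        + (1 / 2) * (S.frameTwist b k q ⬝ᵥ (S.body b).inertia *ᵥ
            (crossMotion (S.frameTwist b i q) *ᵥ S.frameTwist b j q)
          + (crossMotion (S.frameTwist b i q) *ᵥ S.frameTwist b k q) ⬝ᵥ
            (S.body b).inertia *ᵥ S.frameTwist b j q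
          + S.frameTwist b i q ⬝ᵥ (S.body b).inertia *ᵥ
            (crossMotion (S.frameTwist b j q) *ᵥ S.frameTwist b k q))) := by
  have hbr : ∀ (b : t.Body) (i j : t.Speeds),
      bodyTwist (S.pose b) q (VectorField.mlieBracket 𝓘(ℝ, E) (S.frame i) (S.frame j) q) =
        vecDeriv (S.frameTwist b j) q (S.frame i q) - vecDeriv (S.frameTwist b i) q (S.frame j q)
          + crossMotion (S.frameTwist b i q) *ᵥ S.frameTwist b j q := fun b i j =>
    bodyTwist_mlieBracket (S.pose_smooth b) (S.frame_smooth i) (S.frame_smooth j) q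
  simp only [christoffel, dirDeriv_massMatrix, metric, hbr]
  simp only [← Finset.sum_add_distrib, ← Finset.sum_sub_distrib, Finset.mul_sum]
  refine Finset.sum_congr rfl fun b _ => ?_
  have hI := fun v w => dotProduct_mulVec_comm (S.body b).inertia_transpose v w
  change (1 / 2) * (_ + _ - _ + (S.frameTwist b k q ⬝ᵥ _) + (S.frameTwist b j q ⬝ᵥ _)
    + (S.frameTwist b i q ⬝ᵥ _)) = _
  simp only [Matrix.mulVec_add, Matrix.mulVec_sub, dotProduct_add, dotProduct_sub]
  rw [hI (vecDeriv (S.frameTwist b i) q (S.frame k q)),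
    hI (vecDeriv (S.frameTwist b i) q (S.frame j q)),
    hI (vecDeriv (S.frameTwist b j) q (S.frame i q)),
    hI (crossMotion (S.frameTwist b i q) *ᵥ S.frameTwist b k q)]
  ring

theorem bodyTwist_velocity (b : t.Body) (q : Q) (vbar : t.Speeds → ℝ) :
    bodyTwist (S.pose b) q (S.velocity q vbar) = ∑ k, vbar k • S.frameTwist b k q :=
  bodyTwist_sum_smul _ _ _ _ _

/-- The term `x_iᵀ I (v × x_k)` has coefficient `1 / 2` in the contracted Christoffel symbols and
`-1 / 2` in the Niemeyer–Slotine factor. The difference, one full copy, is the cross-product part of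
the inertial rate. -/
theorem coriolisStar_apply [CompleteSpace E] (q : Q) (vbar : t.Speeds → ℝ) (i k : t.Speeds) :
    S.coriolisStar q vbar i k =
      ∑ b, (S.frameTwist b i q ⬝ᵥ bodyFactor (S.body b).inertia
            (bodyTwist (S.pose b) q (S.velocity q vbar)) *ᵥ S.frameTwist b k q
          + S.frameTwist b i q ⬝ᵥ (S.body b).inertia *ᵥ
            S.frameTwistRate b k q (S.velocity q vbar)) := by
  simp only [coriolisStar, Matrix.of_apply, christoffel_eq, Finset.sum_mul]
  rw [Finset.sum_comm]
  refine Finset.sum_congr rfl fun b _ => ?_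
  rw [dotProduct_bodyFactor_mulVec (S.body b).inertia_transpose, frameTwistRate,
    Matrix.mulVec_add, dotProduct_add]
  -- The cross products with `x_k` on the right are reversed, so that the total twist `v` stands in
  -- a linear slot and can be expanded over the speeds.
  have hc := fun w => crossMotion_antisymm w (S.frameTwist b k q)
  simp only [hc, Matrix.mulVec_neg, dotProduct_neg]
  have hd : vecDeriv (S.frameTwist b k) q (S.velocity q vbar) =
      ∑ j, vbar j • vecDeriv (S.frameTwist b k) q (S.frame j q) := vecDeriv_sum_smul _ _ _ _ _
  have h1 := dotProduct_mulVec_sum_smul Finset.univ (S.frameTwist b i q) (S.body b).inertia vbar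
    fun j => vecDeriv (S.frameTwist b k) q (S.frame j q)
  have h2 := dotProduct_mulVec_sum_smul Finset.univ (S.frameTwist b k q)
    ((S.body b).inertia * crossMotion (S.frameTwist b i q)) vbar fun j => S.frameTwist b j q
  have h3 := dotProduct_mulVec_sum_smul Finset.univ
    (crossMotion (S.frameTwist b i q) *ᵥ S.frameTwist b k q) (S.body b).inertia vbar
    fun j => S.frameTwist b j q
  have h4 := dotProduct_mulVec_sum_smul Finset.univ (S.frameTwist b i q)
    ((S.body b).inertia * crossMotion (S.frameTwist b k q)) vbar fun j => S.frameTwist b j q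
  rw [← hd] at h1
  rw [← bodyTwist_velocity] at h2 h3 h4
  simp only [← Matrix.mulVec_mulVec] at h2 h4
  rw [hc (S.frameTwist b i q)] at h3
  rw [h1, h2, h3, h4]
  simp only [Finset.mul_sum, ← Finset.sum_add_distrib, ← Finset.sum_neg_distrib,
    ← Finset.sum_sub_distrib]
  refine Finset.sum_congr rfl fun j _ => ?_
  ring

theorem dotProduct_blockDiagonal_mulVec (M : t.Body → Matrix Tw Tw ℝ) (v w : t.Rows → ℝ) :
    v ⬝ᵥ (Matrix.blockDiagonal' fun i => Matrix.blockDiagonal fun b => M ⟨i, b⟩) *ᵥ w =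
      ∑ b : t.Body, (fun r => v ⟨b.1, (r, b.2)⟩) ⬝ᵥ M b *ᵥ fun r => w ⟨b.1, (r, b.2)⟩ := by
  have h : ∀ (i : Fin N) (r : Tw) (b : Fin (t.bodies i)),
      ((Matrix.blockDiagonal' fun i => Matrix.blockDiagonal fun b => M ⟨i, b⟩) *ᵥ w) ⟨i, (r, b)⟩ =
        (M ⟨i, b⟩ *ᵥ fun r => w ⟨i, (r, b)⟩) r := by
    intro i r b
    rw [Matrix.mulVec, dotProduct, Fintype.sum_sigma, Finset.sum_eq_single i]
    · simp only [Matrix.blockDiagonal'_apply_eq, Fintype.sum_prod_type,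
        Matrix.blockDiagonal_apply, ite_mul, zero_mul, Finset.sum_ite_eq,
        Finset.mem_univ, if_true, Matrix.mulVec, dotProduct]
    · intro j _ hj
      refine Finset.sum_eq_zero fun s _ => ?_
      rw [Matrix.blockDiagonal'_apply_ne _ _ _ hj.symm, zero_mul]
    · simp
  rw [dotProduct, Fintype.sum_sigma, Fintype.sum_sigma]
  refine Finset.sum_congr rfl fun i _ => ?_
  rw [Fintype.sum_prod_type, Finset.sum_comm]
  refine Finset.sum_congr rfl fun b _ => Finset.sum_congr rfl fun r _ => ?_
  rw [h]

theorem coriolisStar_eq [CompleteSpace E] (q : Q) (vbar : t.Speeds → ℝ) :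
    S.coriolisStar q vbar =
      (S.modes q)ᵀ * (S.transform q)ᵀ * S.factor q vbar * S.transform q * S.modes q
        + (S.modes q)ᵀ * (S.transform q)ᵀ * S.inertia * S.transform q * S.modesDot q vbar := by
  have h1 : (S.modes q)ᵀ * (S.transform q)ᵀ * S.factor q vbar * S.transform q * S.modes q =
      (S.transform q * S.modes q)ᵀ * S.factor q vbar * (S.transform q * S.modes q) := by
    rw [Matrix.transpose_mul]
    simp only [Matrix.mul_assoc]
  have h2 : (S.modes q)ᵀ * (S.transform q)ᵀ * S.inertia * S.transform q * S.modesDot q vbar =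
      (S.transform q * S.modes q)ᵀ * S.inertia * (S.transform q * S.modesDot q vbar) := by
    rw [Matrix.transpose_mul]
    simp only [Matrix.mul_assoc]
  ext i k
  rw [h1, h2, Matrix.add_apply, mul_mul_apply_eq_dotProduct, mul_mul_apply_eq_dotProduct,
    coriolisStar_apply, Finset.sum_add_distrib]
  congr 1
  · refine Eq.trans ?_ (dotProduct_blockDiagonal_mulVec (t := t) (fun b =>
      bodyFactor (S.body b).inertia (bodyTwist (S.pose b) q (S.velocity q vbar))) _ _).symm
    simp only [transform_mul_modes_apply]
  · refine Eq.trans ?_ (dotProduct_blockDiagonal_mulVec (t := t) (fun b =>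
      (S.body b).inertia) _ _).symm
    simp only [transform_mul_modes_apply, transform_mul_modesDot_apply]

/-- The metric as a bilinear form. -/
def metricForm (q : Q) : LinearMap.BilinForm ℝ (TangentSpace 𝓘(ℝ, E) q) :=
  ∑ b, (Matrix.toLinearMap₂' ℝ (S.body b).inertia).compl₁₂ (bodyTwistLinear (S.pose b) q)
    (bodyTwistLinear (S.pose b) q)

theorem metricForm_apply (q : Q) (u w : TangentSpace 𝓘(ℝ, E) q) :
    S.metricForm q u w = S.metric q u w := by
  simp only [metricForm, LinearMap.sum_apply, LinearMap.compl₁₂_apply, Matrix.toLinearMap₂'_apply',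
    metric]
  rfl

/-- Koszul's formula: metric compatibility expands the three derivatives, torsion-freeness the three
brackets, and all terms cancel except two copies of the right side. -/
theorem christoffel_eq_connection
    {cov : CovariantDerivative 𝓘(ℝ, E) E (fun q : Q => TangentSpace 𝓘(ℝ, E) q)}
    (hcov : S.IsRiemannianConnection cov) (q : Q) (i j k : t.Speeds) :
    S.christoffel q i j k = S.metric q (S.frame i q) (cov (S.frame k) q (S.frame j q)) := by
  have ht := fun i j => hcov.torsion_free (S.frame i) (S.frame j) (S.frame_smooth i)
    (S.frame_smooth j) q
  have hm := fun i j k => hcov.metric_compatible (S.frame i) (S.frame j) (S.frame k)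
    (S.frame_smooth i) (S.frame_smooth j) (S.frame_smooth k) q
  have hmass : ∀ i j k, dirDeriv (fun x => S.massMatrix x i j) q (S.frame k q) =
      S.metric q (cov (S.frame i) q (S.frame k q)) (S.frame j q)
        + S.metric q (S.frame i q) (cov (S.frame j) q (S.frame k q)) := fun i j k => hm k i j
  rw [christoffel, hmass, hmass, hmass, ← ht, ← ht, ← ht]
  simp only [← metricForm_apply, map_sub]
  simp only [metricForm_apply]
  rw [S.metric_comm q (cov (S.frame i) q (S.frame k q)),
    S.metric_comm q (cov (S.frame i) q (S.frame j q)),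
    S.metric_comm q (cov (S.frame j) q (S.frame i q))]
  ring

theorem coriolisStar_eq_connection
    {cov : CovariantDerivative 𝓘(ℝ, E) E (fun q : Q => TangentSpace 𝓘(ℝ, E) q)}
    (hcov : S.IsRiemannianConnection cov) (q : Q) (vbar : t.Speeds → ℝ) (i k : t.Speeds) :
    S.coriolisStar q vbar i k =
      S.metric q (S.frame i q) (cov (S.frame k) q (S.velocity q vbar)) := by
  simp only [coriolisStar, Matrix.of_apply, S.christoffel_eq_connection hcov, velocity, map_sum,
    map_smul]
  simp only [← metricForm_apply, map_sum, map_smul, smul_eq_mul]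
  exact Finset.sum_congr rfl fun j _ => mul_comm _ _

end MultibodySystem

end Geometry

/-! ### Invariants of loops in the cost monad. -/

namespace Timed

variable {α β : Type}

theorem bind_val (x : Timed α) (f : α → Timed β) : (x >>= f).val = (f x.val).val := rfl

theorem bind_cost (x : Timed α) (f : α → Timed β) :
    (x >>= f).cost = x.cost + (f x.val).cost := rfl

theorem pure_val (a : α) : (pure a : Timed α).val = a := rfl

theorem pure_cost (a : α) : (pure a : Timed α).cost = 0 := rfl

/-- The monad laws allow a loop to be split at its last or first index by `List.foldlM_append`. -/
instance : LawfulMonad Timed := LawfulMonad.mk' _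
  (id_map := fun x => rfl)
  (pure_bind := fun x f => by
    change Timed.mk _ (0 + _) = _
    rw [zero_add]
    rfl)
  (bind_assoc := fun x f g => by
    change Timed.mk _ (_ + _ + _) = Timed.mk _ (_ + (_ + _))
    rw [add_assoc]
    rfl)

theorem foldlM_finRange_induction {σ : Type} {N : ℕ} (f : σ → Fin N → Timed σ)
    (Inv : ℕ → σ → Prop) (s : σ) (h0 : Inv 0 s)
    (hstep : ∀ (i : Fin N) s, Inv i s → Inv (i + 1) (f s i).val) :
    Inv N ((List.finRange N).foldlM f s).val := by
  induction N generalizing s with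
  | zero => exact h0
  | succ n ih =>
    rw [List.finRange_succ_last, List.foldlM_append, bind_val, List.foldlM_map]
    have h := ih (fun s i => f s i.castSucc) s h0 fun i s hi => hstep i.castSucc s hi
    simp only [List.foldlM_cons, List.foldlM_nil]
    exact hstep (Fin.last n) _ h

/-- The index of the invariant is the smallest cluster already processed, with `N` meaning none; it
decreases to `0`. -/
theorem foldlM_reverse_finRange_induction {σ : Type} {N : ℕ} (f : σ → Fin N → Timed σ)
    (Inv : ℕ → σ → Prop) (s : σ) (h0 : Inv N s)
    (hstep : ∀ (i : Fin N) s, Inv (i + 1) s → Inv i (f s i).val) :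
    Inv 0 ((List.finRange N).reverse.foldlM f s).val := by
  induction N generalizing s with
  | zero => exact h0
  | succ n ih =>
    rw [List.finRange_succ_last, List.reverse_append, List.foldlM_append, bind_val,
      ← List.map_reverse, List.foldlM_map]
    simp only [List.reverse_singleton, List.foldlM_cons, List.foldlM_nil]
    exact ih (fun s i => f s i.castSucc) _ (hstep (Fin.last n) s h0)
      fun i s hi => hstep i.castSucc s hi

end Timed

/-! ### Ancestors among clusters. -/

namespace ClusterTree

variable {N : ℕ} (t : ClusterTree N)

/-- The cluster `k` is on the path from the cluster `i` to the ground (`k = i` included). -/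
def Anc (k i : Fin N) : Prop := Relation.ReflTransGen (fun x y => t.parent x = some y) i k

variable {t}

theorem Anc.refl (i : Fin N) : t.Anc i i := Relation.ReflTransGen.refl

theorem anc_iff {k i : Fin N} : t.Anc k i ↔ k = i ∨ ∃ p, t.parent i = some p ∧ t.Anc k p := by
  unfold Anc
  rw [Relation.ReflTransGen.cases_head_iff, eq_comm]

theorem Anc.le {k i : Fin N} (h : t.Anc k i) : k ≤ i := by
  induction h with
  | refl => exact le_rfl
  | tail _ h ih => exact (t.parent_lt h).le.trans ih

theorem Anc.trans {a b c : Fin N} (h : t.Anc a b) (h' : t.Anc b c) : t.Anc a c :=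
  Relation.ReflTransGen.trans h' h

/-- `parent` is a function, so the path from `l` to the ground is unique and its members are
comparable. -/
theorem Anc.total {a b l : Fin N} (ha : t.Anc a l) (hb : t.Anc b l) : t.Anc a b ∨ t.Anc b a := by
  refine (Relation.ReflTransGen.total_of_right_unique ?_ ha hb).symm
  intro x y z hy hz
  exact Option.some.inj (hy.symm.trans hz)

theorem anc_parent {i p : Fin N} (h : t.parent i = some p) : t.Anc p i :=
  Relation.ReflTransGen.single h

theorem anc_of_parent_of_ne {i p k : Fin N} (h : t.parent i = some p) (hk : t.Anc k i)
    (hne : k ≠ i) : t.Anc k p := by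
  rcases anc_iff.1 hk with h1 | ⟨p', h1, h2⟩
  · exact absurd h1 hne
  · rw [h] at h1
    obtain rfl := Option.some.inj h1
    exact h2

end ClusterTree

/-! ### Composite matrices of subtrees. -/

namespace Alg

open ClusterTree

variable {N : ℕ} {t : ClusterTree N} (inp : AlgInput t)

/-- The transforms between all pairs of clusters that are composed of the transforms of the input
along the paths to the ground. -/
structure IsTransform (P : ∀ i k, Matrix (t.Row i) (t.Row k) ℝ) : Prop where
  self : ∀ i, P i i = 1
  of_none : ∀ {i k}, t.parent i = none → k ≠ i → P i k = 0
  of_some : ∀ {i p k} (h : t.parent i = some p), k ≠ i → P i k = inp.toParent i p h * P p k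

variable {inp} {P : ∀ i k, Matrix (t.Row i) (t.Row k) ℝ}

namespace IsTransform

theorem eq_zero (hP : IsTransform inp P) {i k : Fin N} (h : ¬t.Anc k i) : P i k = 0 := by
  induction i using WellFoundedLT.induction with
  | ind i ih =>
    have hk : k ≠ i := by
      rintro rfl
      exact h (Anc.refl k)
    rcases hi : t.parent i with _ | p
    · exact hP.of_none hi hk
    · rw [hP.of_some hi hk, ih p (t.parent_lt hi) fun h' => h (h'.trans (anc_parent hi)),
        Matrix.mul_zero]

theorem toParent_eq (hP : IsTransform inp P) {i p : Fin N} (h : t.parent i = some p) :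
    inp.toParent i p h = P i p := by
  rw [hP.of_some h (t.parent_lt h).ne, hP.self, Matrix.mul_one]

theorem mul_eq (hP : IsTransform inp P) {i j k : Fin N} (hk : t.Anc k j) (hj : t.Anc j i) :
    P i k = P i j * P j k := by
  induction hj using Relation.ReflTransGen.head_induction_on with
  | refl => rw [hP.self, Matrix.one_mul]
  | head h h' ih =>
    have hjp := Anc.le h'
    rw [hP.of_some h (hk.le.trans_lt (hjp.trans_lt (t.parent_lt h))).ne, ih,
      hP.of_some h (hjp.trans_lt (t.parent_lt h)).ne, Matrix.mul_assoc]

end IsTransform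

variable (P)

/-- The block `(a, b)` of `Xᵀ M X` for the block-diagonal matrix `M`. -/
def composite (M : ∀ i, Matrix (t.Row i) (t.Row i) ℝ) (a b : Fin N) : Matrix (t.Row a) (t.Row b) ℝ :=
  ∑ l, (P l a)ᵀ * M l * P l b

open Classical in
/-- The composite matrix of cluster `i` after the clusters from `m` on have been processed. -/
def partialComposite (M : ∀ i, Matrix (t.Row i) (t.Row i) ℝ) (m : ℕ) (i : Fin N) :
    Matrix (t.Row i) (t.Row i) ℝ :=
  ∑ l, if l = i ∨ ∃ c, t.parent c = some i ∧ m ≤ c ∧ t.Anc c l then (P l i)ᵀ * M l * P l i else 0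

variable {P}

/-- Only descendants `l` of `j` contribute, and for these the transform to `a` factors through `j`.
This is why a climb may start from the single matrix stored at `j`. -/
theorem composite_of_anc_left (hP : IsTransform inp P)
    (M : ∀ i, Matrix (t.Row i) (t.Row i) ℝ) {a j : Fin N} (h : t.Anc a j) :
    composite P M a j = (P j a)ᵀ * composite P M j j := by
  simp only [composite, Matrix.mul_sum]
  refine Finset.sum_congr rfl fun l _ => ?_
  by_cases hl : t.Anc j l
  · rw [hP.mul_eq h hl, Matrix.transpose_mul]
    simp only [Matrix.mul_assoc]
  · simp [hP.eq_zero hl]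

theorem composite_of_anc_right (hP : IsTransform inp P)
    (M : ∀ i, Matrix (t.Row i) (t.Row i) ℝ) {a j : Fin N} (h : t.Anc a j) :
    composite P M j a = composite P M j j * P j a := by
  simp only [composite, Matrix.sum_mul]
  refine Finset.sum_congr rfl fun l _ => ?_
  by_cases hl : t.Anc j l
  · rw [hP.mul_eq h hl]
    simp only [Matrix.mul_assoc]
  · simp [hP.eq_zero hl]

/-- A cluster with both `a` and `b` as ancestors would make them comparable. -/
theorem composite_eq_zero (hP : IsTransform inp P)
    (M : ∀ i, Matrix (t.Row i) (t.Row i) ℝ) {a b : Fin N} (hab : ¬t.Anc a b) (hba : ¬t.Anc b a) :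
    composite P M a b = 0 := by
  refine Finset.sum_eq_zero fun l _ => ?_
  by_cases ha : t.Anc a l
  · by_cases hb : t.Anc b l
    · rcases ha.total hb with h | h
      · exact absurd h hab
      · exact absurd h hba
    · rw [hP.eq_zero hb, Matrix.mul_zero]
  · rw [hP.eq_zero ha, Matrix.transpose_zero, Matrix.zero_mul, Matrix.zero_mul]

theorem composite_transpose {M : ∀ i, Matrix (t.Row i) (t.Row i) ℝ} (hM : ∀ i, (M i)ᵀ = M i)
    (a b : Fin N) : (composite P M a b)ᵀ = composite P M b a := by
  simp only [composite, Matrix.transpose_sum, Matrix.transpose_mul, Matrix.transpose_transpose, hM,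
    Matrix.mul_assoc]

theorem partialComposite_last (hP : IsTransform inp P)
    (M : ∀ i, Matrix (t.Row i) (t.Row i) ℝ) (i : Fin N) : partialComposite P M N i = M i := by
  rw [partialComposite, Finset.sum_eq_single i]
  · simp [hP.self]
  · intro l _ hl
    rw [if_neg]
    rintro (h | ⟨c, -, h, -⟩)
    · exact hl h
    · exact absurd c.2 (not_lt.2 h)
  · simp

/-- All children of `i` have index at least `i + 1`, so their subtrees have been added by the time
the backward loop reaches `i`. -/
theorem partialComposite_of_le (hP : IsTransform inp P)
    (M : ∀ i, Matrix (t.Row i) (t.Row i) ℝ) {m : ℕ} {i : Fin N} (hm : m ≤ i + 1) :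
    partialComposite P M m i = composite P M i i := by
  refine Finset.sum_congr rfl fun l _ => ?_
  split_ifs with h
  · rfl
  · rw [hP.eq_zero, Matrix.mul_zero]
    intro hl
    apply h
    rcases Relation.ReflTransGen.cases_tail hl with h1 | ⟨c, h1, h2⟩
    · exact Or.inl h1.symm
    · exact Or.inr ⟨c, h2, hm.trans (t.parent_lt h2), h1⟩

theorem partialComposite_of_ne (M : ∀ i, Matrix (t.Row i) (t.Row i) ℝ) {j i : Fin N}
    (h : t.parent j ≠ some i) : partialComposite P M j i = partialComposite P M (j + 1) i := by
  classical
  refine Finset.sum_congr rfl fun l _ => if_congr (or_congr_right ?_) rfl rfl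
  refine exists_congr fun c => and_congr_right fun hc => and_congr_left fun _ => ?_
  refine ⟨fun h1 => lt_of_le_of_ne h1 ?_, fun h1 => by omega⟩
  intro h2
  exact h (Fin.ext h2 ▸ hc)

/-- Lowering the threshold from `j + 1` to `j` adds to `p` exactly the descendants of `j`, and their
contributions are the composite of `j` carried to `p`. -/
theorem partialComposite_parent (hP : IsTransform inp P)
    (M : ∀ i, Matrix (t.Row i) (t.Row i) ℝ) {j p : Fin N} (h : t.parent j = some p) :
    partialComposite P M j p =
      partialComposite P M (j + 1) p + (P j p)ᵀ * composite P M j j * P j p := by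
  classical
  have hj : (P j p)ᵀ * composite P M j j * P j p =
      ∑ l, (P l j * P j p)ᵀ * M l * (P l j * P j p) := by
    simp only [composite, Matrix.mul_sum, Matrix.sum_mul, Matrix.transpose_mul, Matrix.mul_assoc]
  rw [hj, partialComposite, partialComposite, ← Finset.sum_add_distrib]
  refine Finset.sum_congr rfl fun l _ => ?_
  have hcond : (l = p ∨ ∃ c, t.parent c = some p ∧ (j : ℕ) ≤ c ∧ t.Anc c l) ↔
      (l = p ∨ ∃ c, t.parent c = some p ∧ (j + 1 : ℕ) ≤ c ∧ t.Anc c l) ∨ t.Anc j l := by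
    rw [or_assoc]
    refine or_congr_right ⟨?_, ?_⟩
    · rintro ⟨c, h1, h2, h3⟩
      rcases h2.eq_or_lt with h4 | h4
      · exact Or.inr (Fin.ext h4 ▸ h3)
      · exact Or.inl ⟨c, h1, h4, h3⟩
    · rintro (⟨c, h1, h2, h3⟩ | h1)
      · exact ⟨c, h1, by omega, h3⟩
      · exact ⟨j, h, le_rfl, h1⟩
  by_cases hl : t.Anc j l
  · have hn : ¬(l = p ∨ ∃ c, t.parent c = some p ∧ (j + 1 : ℕ) ≤ c ∧ t.Anc c l) := by
      rintro (rfl | ⟨c, h1, h2, h3⟩)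
      · exact absurd (t.parent_lt h) (not_lt.2 hl.le)
      · have hjc : j < c := h2
        rcases hl.total h3 with h4 | h4
        · have := anc_of_parent_of_ne h1 h4 hjc.ne
          exact absurd (t.parent_lt h) (not_lt.2 this.le)
        · exact absurd hjc (not_lt.2 h4.le)
    rw [if_pos (hcond.2 (Or.inr hl)), if_neg hn, zero_add, ← hP.mul_eq (anc_parent h) hl]
  · rw [hP.eq_zero hl]
    simp only [Matrix.zero_mul, Matrix.mul_zero, add_zero]
    exact if_congr (hcond.trans (or_iff_left hl)) rfl rfl

end Alg

/-! ### Correctness of the forward and backward loops. -/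

namespace Alg

open ClusterTree Timed

variable {N : ℕ} {t : ClusterTree N} (inp : AlgInput t)

theorem twistStep_of_none {i : Fin N} (h : t.parent i = none) (v : ∀ i, t.Row i → ℝ) :
    (twistStep inp v i).val = inp.modes i *ᵥ inp.speeds i := by
  rw [twistStep, bind_val]
  split
  · rfl
  · rename_i p hp
    rw [h] at hp
    simp at hp

theorem twistStep_of_some {i p : Fin N} (h : t.parent i = some p) (v : ∀ i, t.Row i → ℝ) :
    (twistStep inp v i).val = inp.toParent i p h *ᵥ v p + inp.modes i *ᵥ inp.speeds i := by
  rw [twistStep, bind_val]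
  split
  · rename_i hp
    rw [h] at hp
    simp at hp
  · rename_i p' hp
    obtain rfl := Option.some.inj (h.symm.trans hp)
    rfl

theorem twistStep_congr {i : Fin N} {v w : ∀ i, t.Row i → ℝ} (h : ∀ p < i, v p = w p) :
    (twistStep inp v i).val = (twistStep inp w i).val := by
  rcases hi : t.parent i with _ | p
  · rw [twistStep_of_none inp hi, twistStep_of_none inp hi]
  · rw [twistStep_of_some inp hi, twistStep_of_some inp hi, h p (t.parent_lt hi)]

/-- The block-diagonal inertia of a cluster. -/
def clusterInertia (i : Fin N) : Matrix (t.Row i) (t.Row i) ℝ :=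
  Matrix.blockDiagonal (inp.inertia i)

/-- The inertial rate of change of the joint modes of a cluster with twist `v`. -/
def clusterModesDot (i : Fin N) (v : t.Row i → ℝ) : Matrix (t.Row i) (Fin (t.dof i)) ℝ :=
  clusterCross v * inp.modes i + inp.modesRate i

/-- The Niemeyer–Slotine factor of a cluster with twist `v`. -/
def clusterFactor (i : Fin N) (v : t.Row i → ℝ) : Matrix (t.Row i) (t.Row i) ℝ :=
  (1 / 2 : ℝ) • (clusterCrossForce v * clusterInertia inp i
    + clusterCrossForceBar (clusterInertia inp i *ᵥ v) - clusterInertia inp i * clusterCross v)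

theorem forwardStep_val (s : AlgState t) (i : Fin N) :
    (forwardStep inp s i).val = { s with
      v := Function.update s.v i (twistStep inp s.v i).val
      modesDot := Function.update s.modesDot i
        (clusterModesDot inp i (twistStep inp s.v i).val)
      IC := Function.update s.IC i (clusterInertia inp i)
      BC := Function.update s.BC i (clusterFactor inp i (twistStep inp s.v i).val) } := rfl

/-- The twists are characterised as a solution `V` of the recursion, to be supplied by the physical
twists. A pass reads only the twist of the parent, whose index is smaller, so the loop reproduces
`V`. -/
theorem foldlM_forwardStep {V : ∀ i, t.Row i → ℝ} (hV : ∀ i, V i = (twistStep inp V i).val) :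
    ((List.finRange N).foldlM (forwardStep inp) (init t)).val =
      { v := V
        modesDot := fun i => clusterModesDot inp i (V i)
        IC := clusterInertia inp
        BC := fun i => clusterFactor inp i (V i)
        C := fun _ _ => 0 } := by
  have h := foldlM_finRange_induction (forwardStep inp) (fun m s =>
    (∀ i : Fin N, (i : ℕ) < m → s.v i = V i ∧ s.modesDot i = clusterModesDot inp i (V i) ∧
      s.IC i = clusterInertia inp i ∧ s.BC i = clusterFactor inp i (V i)) ∧ s.C = fun _ _ => 0)
    (init t) ⟨fun i hi => absurd hi (Nat.not_lt_zero _), rfl⟩ ?_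
  · obtain ⟨h1, h2⟩ := h
    generalize ((List.finRange N).foldlM (forwardStep inp) (init t)).val = s at h1 h2
    obtain ⟨v, md, IC, BC, C⟩ := s
    rw [AlgState.mk.injEq]
    exact ⟨funext fun i => (h1 i i.2).1, funext fun i => (h1 i i.2).2.1,
      funext fun i => (h1 i i.2).2.2.1, funext fun i => (h1 i i.2).2.2.2, h2⟩
  · rintro i s ⟨h1, h2⟩
    have hv : (twistStep inp s.v i).val = V i := by
      rw [twistStep_congr inp fun p hp => (h1 p hp).1, ← hV]
    rw [forwardStep_val, hv]
    refine ⟨fun k hk => ?_, h2⟩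
    by_cases hki : k = i
    · subst hki
      simp
    · have hlt : (k : ℕ) < i := by
        have : (k : ℕ) ≠ i := fun h => hki (Fin.ext h)
        omega
      simpa [Function.update_of_ne hki] using h1 k hlt

theorem setBlock_same (C : ∀ i j, Matrix (Fin (t.dof i)) (Fin (t.dof j)) ℝ) (i j : Fin N)
    (M : Matrix (Fin (t.dof i)) (Fin (t.dof j)) ℝ) : (setBlock C i j M).val i j = M := by
  simp [setBlock, tick]

theorem setBlock_of_ne (C : ∀ i j, Matrix (Fin (t.dof i)) (Fin (t.dof j)) ℝ) {i j a b : Fin N}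
    (M : Matrix (Fin (t.dof i)) (Fin (t.dof j)) ℝ) (h : ¬(a = i ∧ b = j)) :
    (setBlock C i j M).val a b = C a b := by
  simp only [setBlock, tick]
  by_cases ha : a = i
  · subst ha
    rw [Function.update_self, Function.update_of_ne fun hb => h ⟨rfl, hb⟩]
  · rw [Function.update_of_ne ha]

variable (modesDot : ∀ i, Matrix (t.Row i) (Fin (t.dof i)) ℝ)

theorem climb_of_none (j : Fin N) {i : Fin N} (h : t.parent i = none)
    (f₁ f₂ f₃ : Matrix (t.Row i) (Fin (t.dof j)) ℝ)
    (C : ∀ i j, Matrix (Fin (t.dof i)) (Fin (t.dof j)) ℝ) :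
    climb inp modesDot j i f₁ f₂ f₃ C = tick 1 C := by
  rw [climb]
  split
  · rfl
  · rename_i p hp
    rw [h] at hp
    simp at hp

theorem climb_of_some (j : Fin N) {i p : Fin N} (h : t.parent i = some p)
    (f₁ f₂ f₃ : Matrix (t.Row i) (Fin (t.dof j)) ℝ)
    (C : ∀ i j, Matrix (Fin (t.dof i)) (Fin (t.dof j)) ℝ) :
    climb inp modesDot j i f₁ f₂ f₃ C = (do
      let _ ← tick 1 ()
      let g₁ ← tmul (inp.toParent i p h) f₁
      let g₂ ← tmul (inp.toParent i p h) f₂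
      let g₃ ← tmul (inp.toParent i p h) f₃
      let up ← tmul (inp.modes p) g₁
      let C₁ ← setBlock C p j up
      let l₁ ← tmul (modesDot p) g₂
      let l₂ ← tmul (inp.modes p) g₃
      let l₃ ← plus l₁ l₂
      let low ← write l₃ᵀ
      let C₂ ← setBlock C₁ j p low
      climb inp modesDot j p g₁ g₂ g₃ C₂ : Timed _) := by
  rw [climb]
  split
  · rename_i hp
    rw [h] at hp
    simp at hp
  · rename_i p' hp
    obtain rfl := Option.some.inj (h.symm.trans hp)
    rfl

theorem climb_of_some_val (j : Fin N) {i p : Fin N} (h : t.parent i = some p)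
    (f₁ f₂ f₃ : Matrix (t.Row i) (Fin (t.dof j)) ℝ)
    (C : ∀ i j, Matrix (Fin (t.dof i)) (Fin (t.dof j)) ℝ) :
    (climb inp modesDot j i f₁ f₂ f₃ C).val =
      (climb inp modesDot j p ((inp.toParent i p h)ᵀ * f₁) ((inp.toParent i p h)ᵀ * f₂)
        ((inp.toParent i p h)ᵀ * f₃)
        (setBlock (setBlock C p j ((inp.modes p)ᵀ * ((inp.toParent i p h)ᵀ * f₁))).val j p
          ((modesDot p)ᵀ * ((inp.toParent i p h)ᵀ * f₂)
            + (inp.modes p)ᵀ * ((inp.toParent i p h)ᵀ * f₃))ᵀ).val).val := by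
  rw [climb_of_some inp modesDot j h]
  rfl

variable {inp} {P : ∀ i k, Matrix (t.Row i) (t.Row k) ℝ}

/-- The blocks that are filled in by the inner loop. -/
theorem climb_val (hP : IsTransform inp P) (j i : Fin N) (hij : i ≤ j)
    (f₁ f₂ f₃ : Matrix (t.Row i) (Fin (t.dof j)) ℝ)
    (C : ∀ i j, Matrix (Fin (t.dof i)) (Fin (t.dof j)) ℝ) :
    (∀ a, t.Anc a i → a ≠ i → (climb inp modesDot j i f₁ f₂ f₃ C).val a j =
        (inp.modes a)ᵀ * ((P i a)ᵀ * f₁)) ∧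
    (∀ a, t.Anc a i → a ≠ i → (climb inp modesDot j i f₁ f₂ f₃ C).val j a =
        ((modesDot a)ᵀ * ((P i a)ᵀ * f₂) + (inp.modes a)ᵀ * ((P i a)ᵀ * f₃))ᵀ) ∧
    (∀ a b, ¬(b = j ∧ t.Anc a i ∧ a ≠ i) → ¬(a = j ∧ t.Anc b i ∧ b ≠ i) →
      (climb inp modesDot j i f₁ f₂ f₃ C).val a b = C a b) := by
  induction i using WellFoundedLT.induction generalizing C with
  | ind i ih =>
    rcases hi : t.parent i with _ | p
    · rw [climb_of_none inp modesDot j hi]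
      have hn : ∀ a, t.Anc a i → a ≠ i → False := by
        intro a ha hne
        rcases anc_iff.1 ha with h | ⟨p, h, -⟩
        · exact hne h
        · rw [hi] at h
          simp at h
      exact ⟨fun a ha hne => (hn a ha hne).elim, fun a ha hne => (hn a ha hne).elim,
        fun _ _ _ _ => rfl⟩
    · have hpi := t.parent_lt hi
      have hpj : p ≠ j := (hpi.trans_le hij).ne
      rw [climb_of_some_val inp modesDot j hi]
      obtain ⟨h1, h2, h3⟩ := ih p hpi (hpi.le.trans hij) ((inp.toParent i p hi)ᵀ * f₁)
        ((inp.toParent i p hi)ᵀ * f₂) ((inp.toParent i p hi)ᵀ * f₃)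
        (setBlock (setBlock C p j ((inp.modes p)ᵀ * ((inp.toParent i p hi)ᵀ * f₁))).val j p
          ((modesDot p)ᵀ * ((inp.toParent i p hi)ᵀ * f₂)
            + (inp.modes p)ᵀ * ((inp.toParent i p hi)ᵀ * f₃))ᵀ).val
      have hXP : ∀ a, a ≠ i → ∀ f : Matrix (t.Row i) (Fin (t.dof j)) ℝ,
          (P i a)ᵀ * f = (P p a)ᵀ * ((inp.toParent i p hi)ᵀ * f) := by
        intro a ha f
        rw [hP.of_some hi ha, Matrix.transpose_mul, Matrix.mul_assoc]
      refine ⟨fun a ha hne => ?_, fun a ha hne => ?_, fun a b hab hba => ?_⟩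
      · by_cases hap : a = p
        · subst hap
          -- The rest of the climb writes only at strict ancestors of `p`, and the block `(j, p)`
          -- differs from `(p, j)`, so the block written here survives.
          rw [h3 a j (fun h => h.2.2 rfl) (fun h => hpj h.1),
            setBlock_of_ne _ _ fun h => hpj h.1, setBlock_same, hP.toParent_eq hi]
        · rw [h1 a (anc_of_parent_of_ne hi ha hne) hap, hXP a hne]
      · by_cases hap : a = p
        · subst hap
          rw [h3 j a (fun h => hpj h.1) (fun h => h.2.2 rfl), setBlock_same, hP.toParent_eq hi]
        · rw [h2 a (anc_of_parent_of_ne hi ha hne) hap, hXP a hne, hXP a hne]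
      · have hup : ∀ c, t.Anc c p → t.Anc c i ∧ c ≠ i := fun c hc =>
          ⟨hc.trans (anc_parent hi), (hc.le.trans_lt hpi).ne⟩
        rw [h3 a b (fun h => hab ⟨h.1, hup a h.2.1⟩) (fun h => hba ⟨h.1, hup b h.2.1⟩),
          setBlock_of_ne, setBlock_of_ne]
        · rintro ⟨rfl, rfl⟩
          exact hab ⟨rfl, hup a (Anc.refl a)⟩
        · rintro ⟨rfl, rfl⟩
          exact hba ⟨rfl, hup b (Anc.refl b)⟩

theorem accumulate_of_none {j : Fin N} (h : t.parent j = none)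
    (M : ∀ i, Matrix (t.Row i) (t.Row i) ℝ) : (accumulate inp M j).val = M := by
  rw [accumulate]
  split
  · rfl
  · rename_i p hp
    rw [h] at hp
    simp at hp

theorem accumulate_of_some {j p : Fin N} (h : t.parent j = some p)
    (M : ∀ i, Matrix (t.Row i) (t.Row i) ℝ) :
    (accumulate inp M j).val = Function.update M p
      (M p + (inp.toParent j p h)ᵀ * (M j * inp.toParent j p h)) := by
  rw [accumulate]
  split
  · rename_i hp
    rw [h] at hp
    simp at hp
  · rename_i p' hp
    obtain rfl := Option.some.inj (h.symm.trans hp)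
    rfl

theorem accumulate_partialComposite (hP : IsTransform inp P)
    {M M' : ∀ i, Matrix (t.Row i) (t.Row i) ℝ} {j : Fin N}
    (hM : ∀ i, M' i = partialComposite P M (j + 1) i) (i : Fin N) :
    (accumulate inp M' j).val i = partialComposite P M j i := by
  rcases hj : t.parent j with _ | p
  · rw [accumulate_of_none hj, hM, partialComposite_of_ne M (by simp [hj])]
  · rw [accumulate_of_some hj]
    by_cases hi : i = p
    · subst hi
      -- The threshold `j + 1` is just low enough for the matrix stored at `j` to be the complete
      -- composite.
      rw [Function.update_self, hM, hM j, partialComposite_of_le hP M le_rfl,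
        partialComposite_parent hP M hj, hP.toParent_eq hj, Matrix.mul_assoc]
    · rw [Function.update_of_ne hi, hM, partialComposite_of_ne M]
      rw [hj]
      exact fun h => hi (Option.some.inj h).symm

theorem backwardStep_val (s : AlgState t) (j : Fin N) :
    (backwardStep inp s j).val = { s with
      C := (climb inp s.modesDot j j (s.IC j * s.modesDot j + s.BC j * inp.modes j)
        (s.IC j * inp.modes j) ((s.BC j)ᵀ * inp.modes j)
        (setBlock s.C j j
          ((inp.modes j)ᵀ * (s.IC j * s.modesDot j + s.BC j * inp.modes j))).val).val
      IC := (accumulate inp s.IC j).val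
      BC := (accumulate inp s.BC j).val } := rfl

/-- The block `(a, b)` of `Φᵀ (Xᵀ B X Φ + Xᵀ H X Φ̇)`. -/
def coriolisBlock (P : ∀ i k, Matrix (t.Row i) (t.Row k) ℝ)
    (modes modesDot : ∀ i, Matrix (t.Row i) (Fin (t.dof i)) ℝ)
    (I B : ∀ i, Matrix (t.Row i) (t.Row i) ℝ) (a b : Fin N) :
    Matrix (Fin (t.dof a)) (Fin (t.dof b)) ℝ :=
  (modes a)ᵀ * (composite P I a b * modesDot b + composite P B a b * modes b)

/-- A block is final as soon as the larger of its two indices has been processed. The pass at `j`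
writes the diagonal block and those pairing `j` with its strict ancestors. Below the diagonal the
transposed product requires a symmetric `I`, while `B` need not be symmetric, which is why `f₃`
starts from `Bᵀ`. -/
theorem backwardStep_C (hP : IsTransform inp P) {I B : ∀ i, Matrix (t.Row i) (t.Row i) ℝ}
    (hI : ∀ i, (I i)ᵀ = I i) (s : AlgState t) (j : Fin N)
    (hIC : s.IC j = composite P I j j) (hBC : s.BC j = composite P B j j)
    (hC : ∀ a b, s.C a b = if (j : ℕ) + 1 ≤ max (a : ℕ) b then
      coriolisBlock P inp.modes s.modesDot I B a b else 0) (a b : Fin N) :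
    (backwardStep inp s j).val.C a b = if (j : ℕ) ≤ max (a : ℕ) b then
      coriolisBlock P inp.modes s.modesDot I B a b else 0 := by
  rw [backwardStep_val]
  simp only
  obtain ⟨h1, h2, h3⟩ := climb_val s.modesDot hP j j le_rfl
    (s.IC j * s.modesDot j + s.BC j * inp.modes j) (s.IC j * inp.modes j)
    ((s.BC j)ᵀ * inp.modes j)
    (setBlock s.C j j ((inp.modes j)ᵀ * (s.IC j * s.modesDot j + s.BC j * inp.modes j))).val
  by_cases hup : b = j ∧ t.Anc a j ∧ a ≠ j
  · obtain ⟨rfl, ha, hne⟩ := hup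
    rw [h1 a ha hne, if_pos (le_max_right _ _), coriolisBlock, composite_of_anc_left hP I ha,
      composite_of_anc_left hP B ha, hIC, hBC, Matrix.mul_add ((P b a)ᵀ)]
    simp only [Matrix.mul_assoc]
  by_cases hlow : a = j ∧ t.Anc b j ∧ b ≠ j
  · obtain ⟨rfl, hb, hne⟩ := hlow
    rw [h2 b hb hne, if_pos (le_max_left _ _), coriolisBlock, composite_of_anc_right hP I hb,
      composite_of_anc_right hP B hb, hIC, hBC]
    simp only [Matrix.transpose_add, Matrix.transpose_mul, Matrix.transpose_transpose,
      composite_transpose hI, Matrix.mul_add, Matrix.mul_assoc]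
  rw [h3 a b hup hlow]
  by_cases hjj : a = j ∧ b = j
  · obtain ⟨rfl, rfl⟩ := hjj
    rw [setBlock_same, if_pos (le_max_left _ _), coriolisBlock, hIC, hBC]
  rw [setBlock_of_ne _ _ hjj, hC]
  by_cases hlt : (j : ℕ) + 1 ≤ max (a : ℕ) b
  · rw [if_pos hlt, if_pos (by omega)]
  rw [if_neg hlt]
  split_ifs with heq
  · have hanc : ¬t.Anc a b ∧ ¬t.Anc b a := by
      have hmax : (a = j ∧ b ≤ j) ∨ (b = j ∧ a ≤ j) := by
        simp only [Fin.ext_iff, Fin.le_def]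
        omega
      rcases hmax with ⟨rfl, hle⟩ | ⟨rfl, hle⟩
      · refine ⟨fun h => hjj ⟨rfl, le_antisymm hle h.le⟩, fun h => hlow ⟨rfl, h, ?_⟩⟩
        exact fun h' => hjj ⟨rfl, h'⟩
      · refine ⟨fun h => hup ⟨rfl, h, ?_⟩, fun h => hjj ⟨le_antisymm hle h.le, rfl⟩⟩
        exact fun h' => hjj ⟨h', rfl⟩
    rw [coriolisBlock, composite_eq_zero hP I hanc.1 hanc.2, composite_eq_zero hP B hanc.1 hanc.2]
    simp
  · rfl

theorem foldlM_backwardStep_C (hP : IsTransform inp P)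
    {I B : ∀ i, Matrix (t.Row i) (t.Row i) ℝ} (hI : ∀ i, (I i)ᵀ = I i) (s : AlgState t)
    (hIC : s.IC = I) (hBC : s.BC = B) (hC : s.C = fun _ _ => 0) (a b : Fin N) :
    ((List.finRange N).reverse.foldlM (backwardStep inp) s).val.C a b =
      coriolisBlock P inp.modes s.modesDot I B a b := by
  have h := foldlM_reverse_finRange_induction (backwardStep inp) (fun m s' =>
    s'.modesDot = s.modesDot ∧ (∀ i, s'.IC i = partialComposite P I m i) ∧
    (∀ i, s'.BC i = partialComposite P B m i) ∧ ∀ a b, s'.C a b =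
      if m ≤ max (a : ℕ) b then coriolisBlock P inp.modes s.modesDot I B a b else 0) s ?_ ?_
  · simpa using h.2.2.2 a b
  · refine ⟨rfl, fun i => by rw [hIC, partialComposite_last hP],
      fun i => by rw [hBC, partialComposite_last hP], fun a b => ?_⟩
    rw [hC, if_neg]
    have := a.2
    have := b.2
    omega
  · rintro j s' ⟨h1, h2, h3, h4⟩
    refine ⟨h1, accumulate_partialComposite hP h2, accumulate_partialComposite hP h3, ?_⟩
    rw [← h1] at h4 ⊢
    exact backwardStep_C hP hI s' j (by rw [h2, partialComposite_of_le hP I le_rfl])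
      (by rw [h3, partialComposite_of_le hP B le_rfl]) h4

theorem coriolis_val (hP : IsTransform inp P) (hI : ∀ i b, (inp.inertia i b)ᵀ = inp.inertia i b)
    {V : ∀ i, t.Row i → ℝ} (hV : ∀ i, V i = (twistStep inp V i).val) :
    (coriolis inp).val = Matrix.of fun a b =>
      coriolisBlock P inp.modes (fun i => clusterModesDot inp i (V i)) (clusterInertia inp)
        (fun i => clusterFactor inp i (V i)) a.1 b.1 a.2 b.2 := by
  rw [coriolis, bind_val, foldlM_forwardStep inp hV, bind_val, pure_val]
  have hI' : ∀ i, (clusterInertia inp i)ᵀ = clusterInertia inp i := by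
    intro i
    rw [clusterInertia, Matrix.blockDiagonal_transpose]
    simp only [hI]
  ext a b
  simp only [Matrix.of_apply]
  rw [foldlM_backwardStep_C hP hI' _ rfl rfl rfl]

end Alg

/-! ### The algorithm computes the Coriolis matrix. -/

section Geometry

variable {E : Type*} [NormedAddCommGroup E] [NormedSpace ℝ E]
  {Q : Type*} [TopologicalSpace Q] [ChartedSpace E Q]

namespace MultibodySystem

variable [IsManifold 𝓘(ℝ, E) ∞ Q] {N : ℕ} {t : ClusterTree N} (S : MultibodySystem t E Q)

theorem isTransform_block (q : Q) (vbar : t.Speeds → ℝ) :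
    Alg.IsTransform (S.algInput q vbar) (S.block q) where
  self := S.block_self q
  of_none h hk := S.block_of_none h q hk
  of_some h hk := S.block_of_some h q hk

theorem blockDiagonal'_mulVec_apply {ι : Type*} [Fintype ι] [DecidableEq ι] {m n : ι → Type*}
    [∀ i, Fintype (n i)] (M : ∀ i, Matrix (m i) (n i) ℝ) (w : (Σ i, n i) → ℝ) (i : ι) (r : m i) :
    (Matrix.blockDiagonal' M *ᵥ w) ⟨i, r⟩ = (M i *ᵥ fun s => w ⟨i, s⟩) r := by
  rw [Matrix.mulVec, dotProduct, Fintype.sum_sigma, Finset.sum_eq_single i]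
  · simp only [Matrix.blockDiagonal'_apply_eq]
    rfl
  · intro j _ hj
    refine Finset.sum_eq_zero fun s _ => ?_
    rw [Matrix.blockDiagonal'_apply_ne _ _ _ hj.symm, zero_mul]
  · simp

theorem clusterTwist_eq_twistStep (q : Q) (vbar : t.Speeds → ℝ) (i : Fin N) :
    S.clusterTwist q vbar i =
      (Alg.twistStep (S.algInput q vbar) (S.clusterTwist q vbar) i).val := by
  funext r
  rcases hi : t.parent i with _ | p
  · rw [Alg.twistStep_of_none _ hi, S.clusterTwist_of_none hi, modes, blockDiagonal'_mulVec_apply]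
    rfl
  · rw [Alg.twistStep_of_some _ hi, S.clusterTwist_of_some hi, modes, blockDiagonal'_mulVec_apply]
    rfl

theorem transform_mul_blockDiagonal'_apply (q : Q)
    (φ : ∀ i, Matrix (t.Row i) (Fin (t.dof i)) ℝ) (l : Fin N) (r : t.Row l) (a : t.Speeds) :
    (S.transform q * Matrix.blockDiagonal' φ) ⟨l, r⟩ a = (S.block q l a.1 * φ a.1) r a.2 := by
  obtain ⟨k, α⟩ := a
  rw [Matrix.mul_apply, Fintype.sum_sigma, Finset.sum_eq_single k]
  · refine Eq.trans ?_ Matrix.mul_apply.symm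
    exact Finset.sum_congr rfl fun s _ =>
      congrArg _ (Matrix.blockDiagonal'_apply_eq φ k s α)
  · intro j _ hj
    refine Finset.sum_eq_zero fun s _ => ?_
    rw [Matrix.blockDiagonal'_apply_ne _ _ _ hj, mul_zero]
  · simp

theorem quadratic_apply (q : Q) (φ ψ : ∀ i, Matrix (t.Row i) (Fin (t.dof i)) ℝ)
    (M : ∀ i, Matrix (t.Row i) (t.Row i) ℝ) (a b : t.Speeds) :
    ((Matrix.blockDiagonal' φ)ᵀ * (S.transform q)ᵀ * Matrix.blockDiagonal' M * S.transform q
      * Matrix.blockDiagonal' ψ) a b =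
    ((φ a.1)ᵀ * (Alg.composite (S.block q) M a.1 b.1 * ψ b.1)) a.2 b.2 := by
  have h1 : (Matrix.blockDiagonal' φ)ᵀ * (S.transform q)ᵀ * Matrix.blockDiagonal' M * S.transform q
      * Matrix.blockDiagonal' ψ = (S.transform q * Matrix.blockDiagonal' φ)ᵀ
        * Matrix.blockDiagonal' M * (S.transform q * Matrix.blockDiagonal' ψ) := by
    rw [Matrix.transpose_mul]
    simp only [Matrix.mul_assoc]
  have h2 : (φ a.1)ᵀ * (Alg.composite (S.block q) M a.1 b.1 * ψ b.1) =
      ∑ l, (S.block q l a.1 * φ a.1)ᵀ * M l * (S.block q l b.1 * ψ b.1) := by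
    simp only [Alg.composite, Matrix.sum_mul, Matrix.mul_sum, Matrix.transpose_mul,
      Matrix.mul_assoc]
  rw [h1, h2, mul_mul_apply_eq_dotProduct, Matrix.sum_apply, dotProduct, Fintype.sum_sigma]
  refine Finset.sum_congr rfl fun l _ => ?_
  refine Eq.trans ?_ (mul_mul_apply_eq_dotProduct (S.block q l a.1 * φ a.1) (M l)
    (S.block q l b.1 * ψ b.1) a.2 b.2).symm
  refine Finset.sum_congr rfl fun r _ => ?_
  simp only [blockDiagonal'_mulVec_apply, transform_mul_blockDiagonal'_apply]

/-- The algorithm forms the factor per cluster, the definition per body; they agree because sums and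
products of block-diagonal matrices are taken blockwise. -/
theorem factor_eq (q : Q) (vbar : t.Speeds → ℝ) :
    S.factor q vbar = Matrix.blockDiagonal' fun i =>
      Alg.clusterFactor (S.algInput q vbar) i (S.clusterTwist q vbar i) := by
  rw [factor]
  congr 1
  funext i
  have h : (fun b => fun r => ((Alg.clusterInertia (S.algInput q vbar) i) *ᵥ
      S.clusterTwist q vbar i) (r, b)) = fun b => (S.body ⟨i, b⟩).inertia *ᵥ fun r =>
        S.clusterTwist q vbar i (r, b) := by
    funext b r
    simp only [Alg.clusterInertia, Matrix.mulVec, dotProduct, Fintype.sum_prod_type,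
      Matrix.blockDiagonal_apply, ite_mul, zero_mul, Finset.sum_ite_eq, Finset.mem_univ, if_true]
    rfl
  have h' : clusterCrossForceBar ((Alg.clusterInertia (S.algInput q vbar) i) *ᵥ
      S.clusterTwist q vbar i) = Matrix.blockDiagonal fun b =>
        crossForceBar ((S.body ⟨i, b⟩).inertia *ᵥ fun r => S.clusterTwist q vbar i (r, b)) := by
    rw [clusterCrossForceBar]
    congr 1
    funext b
    exact congrArg crossForceBar (congrFun h b)
  rw [Alg.clusterFactor, h', Alg.clusterInertia, clusterCrossForce, clusterCross,
    ← Matrix.blockDiagonal_mul, ← Matrix.blockDiagonal_mul, ← Matrix.blockDiagonal_add,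
    ← Matrix.blockDiagonal_sub, ← Matrix.blockDiagonal_smul]
  rfl

theorem modesDot_eq (q : Q) (vbar : t.Speeds → ℝ) :
    S.modesDot q vbar = Matrix.blockDiagonal' fun i =>
      Alg.clusterModesDot (S.algInput q vbar) i (S.clusterTwist q vbar i) := by
  rw [modesDot, modes, ← Matrix.blockDiagonal'_mul, ← Matrix.blockDiagonal'_add]
  rfl

theorem coriolis_val_eq [CompleteSpace E] (q : Q) (vbar : t.Speeds → ℝ) :
    (Alg.coriolis (S.algInput q vbar)).val = S.coriolisStar q vbar := by
  rw [Alg.coriolis_val (S.isTransform_block q vbar)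
    (fun i b => (S.body ⟨i, b⟩).inertia_transpose) (S.clusterTwist_eq_twistStep q vbar),
    coriolisStar_eq, factor_eq, modesDot_eq]
  ext a b
  rw [Matrix.add_apply, modes, inertia, quadratic_apply, quadratic_apply, Matrix.of_apply,
    Alg.coriolisBlock, Matrix.mul_add, Matrix.add_apply, add_comm]
  rfl

end MultibodySystem

end Geometry

/-! ### The operation count -/

namespace ClusterTree

variable {N : ℕ} (t : ClusterTree N)

theorem level_of_none {i : Fin N} (h : t.parent i = none) : t.level i = 1 := by
  rw [level]
  split
  · rfl
  · rename_i p hp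
    rw [h] at hp
    simp at hp

theorem level_of_some {i p : Fin N} (h : t.parent i = some p) : t.level i = t.level p + 1 := by
  rw [level]
  split
  · rename_i hp
    rw [h] at hp
    simp at hp
  · rename_i p' hp
    obtain rfl := Option.some.inj (h.symm.trans hp)
    rfl

theorem one_le_level (i : Fin N) : 1 ≤ t.level i := by
  rcases h : t.parent i with _ | p
  · rw [t.level_of_none h]
  · rw [t.level_of_some h]
    exact Nat.le_add_left _ _

theorem level_le_depth (i : Fin N) : t.level i ≤ t.depth :=
  Finset.le_sup (f := t.level) (Finset.mem_univ i)

end ClusterTree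

namespace Timed

theorem foldlM_cost_le {σ α : Type} (f : σ → α → Timed σ) (c : ℕ)
    (h : ∀ s a, (f s a).cost ≤ c) (l : List α) (s : σ) : (l.foldlM f s).cost ≤ l.length * c := by
  induction l generalizing s with
  | nil => exact Nat.zero_le _
  | cons a l ih =>
    rw [List.foldlM_cons, bind_cost, List.length_cons, Nat.succ_mul, add_comm]
    exact Nat.add_le_add (ih _) (h s a)

variable {l m n : Type} [Fintype l] [Fintype m] [Fintype n] {k : ℕ}

theorem two_mul_card_le (hl : Fintype.card l ≤ k) (hm : Fintype.card m ≤ k)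
    (hn : Fintype.card n ≤ k) : 2 * (Fintype.card l * Fintype.card m * Fintype.card n) ≤ 2 * k ^ 3 := by
  have h := Nat.mul_le_mul (Nat.mul_le_mul hl hm) hn
  have h2 : k ^ 3 = k * k * k := by ring
  omega

/-- Quadratic costs are padded to `k ^ 3`, so that all later estimates are linear in this one
quantity. -/
theorem card_mul_card_le (hk : 1 ≤ k) (hl : Fintype.card l ≤ k) (hm : Fintype.card m ≤ k) :
    Fintype.card l * Fintype.card m ≤ k ^ 3 := by
  have h := Nat.mul_le_mul (Nat.mul_le_mul hl hm) hk
  have h2 : k ^ 3 = k * k * k := by ring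
  omega

end Timed

namespace Alg

open ClusterTree Timed

variable {N : ℕ} {t : ClusterTree N} (inp : AlgInput t) {k : ℕ}

/-- A common bound for the numbers of rows and columns of all matrices of the algorithm. -/
def SizeBound (t : ClusterTree N) (k : ℕ) : Prop :=
  1 ≤ k ∧ (∀ i, Fintype.card (t.Row i) ≤ k) ∧ ∀ i, t.dof i ≤ k

variable {inp}

theorem twistStep_cost_le (hk : SizeBound t k) (v : ∀ i, t.Row i → ℝ) (i : Fin N) :
    (twistStep inp v i).cost ≤ 5 * k ^ 3 := by
  obtain ⟨h1, hr, hd⟩ := hk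
  have hd' : ∀ i, Fintype.card (Fin (t.dof i)) ≤ k := fun i => by simpa using hd i
  have e1 := card_mul_card_le h1 (hr i) (hd' i)
  rw [twistStep, bind_cost]
  change 2 * (Fintype.card (t.Row i) * Fintype.card (Fin (t.dof i))) + _ ≤ _
  split
  · rw [pure_cost]
    omega
  · rename_i p hp
    have e2 := card_mul_card_le h1 (hr i) (hr p)
    have e3 : Fintype.card (t.Row i) ≤ k ^ 3 := (hr i).trans (Nat.le_self_pow (by norm_num) k)
    change _ + (2 * (Fintype.card (t.Row i) * Fintype.card (t.Row p))
      + Fintype.card (t.Row i)) ≤ _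
    omega

theorem forwardStep_cost_le (hk : SizeBound t k) (s : AlgState t) (i : Fin N) :
    (forwardStep inp s i).cost ≤ 25 * k ^ 3 := by
  have ht := twistStep_cost_le (inp := inp) hk s.v i
  obtain ⟨h1, hr, hd⟩ := hk
  have hd' : ∀ i, Fintype.card (Fin (t.dof i)) ≤ k := fun i => by simpa using hd i
  have e1 := card_mul_card_le h1 (hr i) (hd' i)
  have e2 := card_mul_card_le h1 (hr i) (hr i)
  have e3 := two_mul_card_le (hr i) (hr i) (hd' i)
  have e4 := two_mul_card_le (hr i) (hr i) (hr i)
  change (twistStep inp s.v i).cost + (Fintype.card (t.Row i) * Fintype.card (t.Row i)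
    + (2 * (Fintype.card (t.Row i) * Fintype.card (t.Row i) * Fintype.card (Fin (t.dof i)))
    + (Fintype.card (t.Row i) * Fintype.card (Fin (t.dof i))
    + (Fintype.card (t.Row i) * Fintype.card (t.Row i)
    + (Fintype.card (t.Row i) * Fintype.card (t.Row i)
    + (2 * (Fintype.card (t.Row i) * Fintype.card (t.Row i) * Fintype.card (t.Row i))
    + (2 * (Fintype.card (t.Row i) * Fintype.card (t.Row i))
    + (Fintype.card (t.Row i) * Fintype.card (t.Row i)
    + (2 * (Fintype.card (t.Row i) * Fintype.card (t.Row i) * Fintype.card (t.Row i))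
    + (Fintype.card (t.Row i) * Fintype.card (t.Row i)
    + (Fintype.card (t.Row i) * Fintype.card (t.Row i)
    + (Fintype.card (t.Row i) * Fintype.card (t.Row i) + 0)))))))))))) ≤ _
  omega

theorem dof_mul_dof_le (hk : SizeBound t k) (i j : Fin N) : t.dof i * t.dof j ≤ k ^ 3 := by
  simpa using card_mul_card_le (l := Fin (t.dof i)) (m := Fin (t.dof j)) hk.1
    (by simpa using hk.2.2 i) (by simpa using hk.2.2 j)

/-- In units of `k ^ 3`, a pass costs `2` for each of its six products and `1` for each of the test,
the sum, the transposition and the two assignments: `17` in all. -/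
theorem climb_cost_le (hk : SizeBound t k) (md : ∀ i, Matrix (t.Row i) (Fin (t.dof i)) ℝ)
    (j i : Fin N) (f₁ f₂ f₃ : Matrix (t.Row i) (Fin (t.dof j)) ℝ)
    (C : ∀ i j, Matrix (Fin (t.dof i)) (Fin (t.dof j)) ℝ) :
    (climb inp md j i f₁ f₂ f₃ C).cost ≤ 17 * k ^ 3 * t.level i := by
  have h0 : 1 ≤ k ^ 3 := Nat.one_le_pow _ _ hk.1
  induction i using WellFoundedLT.induction generalizing C with
  | ind i ih =>
    rcases hi : t.parent i with _ | p
    · rw [climb_of_none inp md j hi, t.level_of_none hi]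
      change 1 ≤ _
      omega
    · have hp := ih p (t.parent_lt hi) ((inp.toParent i p hi)ᵀ * f₁)
        ((inp.toParent i p hi)ᵀ * f₂) ((inp.toParent i p hi)ᵀ * f₃)
        (setBlock (setBlock C p j ((inp.modes p)ᵀ * ((inp.toParent i p hi)ᵀ * f₁))).val j p
          ((md p)ᵀ * ((inp.toParent i p hi)ᵀ * f₂)
            + (inp.modes p)ᵀ * ((inp.toParent i p hi)ᵀ * f₃))ᵀ).val
      have e1 := dof_mul_dof_le hk p j
      have e2 := dof_mul_dof_le hk j p
      obtain ⟨h1, hr, hd⟩ := hk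
      have hd' : ∀ i, Fintype.card (Fin (t.dof i)) ≤ k := fun i => by simpa using hd i
      have e3 := two_mul_card_le (hr p) (hr i) (hd' j)
      have e4 := two_mul_card_le (hd' p) (hr p) (hd' j)
      have e5 := card_mul_card_le h1 (hd' p) (hd' j)
      have e6 := card_mul_card_le h1 (hd' j) (hd' p)
      rw [climb_of_some inp md j hi, t.level_of_some hi, Nat.mul_succ]
      -- The cost of the remaining climb is abstracted to `c`; the actual cost is an instance of
      -- this expression by unfolding.
      have hc : ∀ c, c ≤ 17 * k ^ 3 * t.level p →
        1 + (2 * (Fintype.card (t.Row p) * Fintype.card (t.Row i) * Fintype.card (Fin (t.dof j)))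
        + (2 * (Fintype.card (t.Row p) * Fintype.card (t.Row i) * Fintype.card (Fin (t.dof j)))
        + (2 * (Fintype.card (t.Row p) * Fintype.card (t.Row i) * Fintype.card (Fin (t.dof j)))
        + (2 * (Fintype.card (Fin (t.dof p)) * Fintype.card (t.Row p)
            * Fintype.card (Fin (t.dof j)))
        + (t.dof p * t.dof j
        + (2 * (Fintype.card (Fin (t.dof p)) * Fintype.card (t.Row p)
            * Fintype.card (Fin (t.dof j)))
        + (2 * (Fintype.card (Fin (t.dof p)) * Fintype.card (t.Row p)
            * Fintype.card (Fin (t.dof j)))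
        + (Fintype.card (Fin (t.dof p)) * Fintype.card (Fin (t.dof j))
        + (Fintype.card (Fin (t.dof j)) * Fintype.card (Fin (t.dof p))
        + (t.dof j * t.dof p + c)))))))))) ≤ 17 * k ^ 3 * t.level p + 17 * k ^ 3 := by
        intro c hc
        omega
      exact hc _ hp

theorem accumulate_cost_le (hk : SizeBound t k) (M : ∀ i, Matrix (t.Row i) (t.Row i) ℝ)
    (j : Fin N) : (accumulate inp M j).cost ≤ 5 * k ^ 3 := by
  have h0 : 1 ≤ k ^ 3 := Nat.one_le_pow _ _ hk.1
  obtain ⟨h1, hr, -⟩ := hk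
  rw [accumulate]
  split
  · change 1 ≤ _
    omega
  · rename_i p hp
    have e1 := two_mul_card_le (hr j) (hr j) (hr p)
    have e2 := two_mul_card_le (hr p) (hr j) (hr p)
    have e3 := card_mul_card_le h1 (hr p) (hr p)
    change 2 * (Fintype.card (t.Row j) * Fintype.card (t.Row j) * Fintype.card (t.Row p))
      + (2 * (Fintype.card (t.Row p) * Fintype.card (t.Row j) * Fintype.card (t.Row p))
      + (Fintype.card (t.Row p) * Fintype.card (t.Row p) + 0)) ≤ _
    omega

theorem backwardStep_cost_le (hk : SizeBound t k) (s : AlgState t) (j : Fin N) :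
    (backwardStep inp s j).cost ≤ 39 * k ^ 3 * t.depth := by
  have hc := climb_cost_le (inp := inp) hk s.modesDot j j
    (s.IC j * s.modesDot j + s.BC j * inp.modes j) (s.IC j * inp.modes j)
    ((s.BC j)ᵀ * inp.modes j)
    (setBlock s.C j j ((inp.modes j)ᵀ * (s.IC j * s.modesDot j + s.BC j * inp.modes j))).val
  have hI := accumulate_cost_le (inp := inp) hk s.IC j
  have hB := accumulate_cost_le (inp := inp) hk s.BC j
  have e1 := dof_mul_dof_le hk j j
  have hl1 := Nat.mul_le_mul_left (22 * k ^ 3) (t.one_le_level j)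
  have hl := Nat.mul_le_mul_left (39 * k ^ 3) (t.level_le_depth j)
  obtain ⟨h1, hr, hd⟩ := hk
  have hd' : ∀ i, Fintype.card (Fin (t.dof i)) ≤ k := fun i => by simpa using hd i
  have e2 := two_mul_card_le (hr j) (hr j) (hd' j)
  have e3 := two_mul_card_le (hd' j) (hr j) (hd' j)
  have e4 := card_mul_card_le h1 (hr j) (hd' j)
  refine le_trans ?_ hl
  change 2 * (Fintype.card (t.Row j) * Fintype.card (t.Row j) * Fintype.card (Fin (t.dof j)))
    + (2 * (Fintype.card (t.Row j) * Fintype.card (t.Row j) * Fintype.card (Fin (t.dof j)))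
    + (Fintype.card (t.Row j) * Fintype.card (Fin (t.dof j))
    + (2 * (Fintype.card (t.Row j) * Fintype.card (t.Row j) * Fintype.card (Fin (t.dof j)))
    + (2 * (Fintype.card (t.Row j) * Fintype.card (t.Row j) * Fintype.card (Fin (t.dof j)))
    + (2 * (Fintype.card (Fin (t.dof j)) * Fintype.card (t.Row j) * Fintype.card (Fin (t.dof j)))
    + (t.dof j * t.dof j + (Timed.cost (climb inp s.modesDot j j
      (s.IC j * s.modesDot j + s.BC j * inp.modes j) (s.IC j * inp.modes j)
      ((s.BC j)ᵀ * inp.modes j)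
      (setBlock s.C j j ((inp.modes j)ᵀ * (s.IC j * s.modesDot j + s.BC j * inp.modes j))).val)
    + ((accumulate inp s.IC j).cost + ((accumulate inp s.BC j).cost + 0))))))))) ≤ _
  -- Outside the climb the pass costs at most `12 + 5 + 5 = 22` units, absorbed into the level
  -- because a level is at least one.
  have hsplit : 39 * k ^ 3 * t.level j = 17 * k ^ 3 * t.level j + 22 * k ^ 3 * t.level j := by ring
  omega

/-- The algorithm takes `O(N d)` operations for clusters of bounded size. -/
theorem coriolis_cost_le (hk : SizeBound t k) :
    (coriolis inp).cost ≤ 64 * k ^ 3 * (N * t.depth) := by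
  have hf := foldlM_cost_le (forwardStep inp) (25 * k ^ 3)
    (fun s i => forwardStep_cost_le hk s i) (List.finRange N) (init t)
  have hb := foldlM_cost_le (backwardStep inp) (39 * k ^ 3 * t.depth)
    (fun s j => backwardStep_cost_le hk s j) (List.finRange N).reverse
    ((List.finRange N).foldlM (forwardStep inp) (init t)).val
  rw [List.length_reverse] at hb
  rw [List.length_finRange] at hf hb
  -- The forward loop is linear in `N`; a tree with at least one cluster has depth at least one, so
  -- the factor `t.depth` may be inserted.
  have hN : N * (25 * k ^ 3) ≤ 25 * k ^ 3 * (N * t.depth) := by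
    rcases Nat.eq_zero_or_pos N with rfl | hN
    · simp
    · have hd : 1 ≤ t.depth := (t.one_le_level ⟨0, hN⟩).trans (t.level_le_depth _)
      calc N * (25 * k ^ 3) = 25 * k ^ 3 * (N * 1) := by ring
        _ ≤ _ := Nat.mul_le_mul_left _ (Nat.mul_le_mul_left _ hd)
  have hb' : N * (39 * k ^ 3 * t.depth) = 39 * k ^ 3 * (N * t.depth) := by ring
  have hsum : 64 * k ^ 3 * (N * t.depth) =
      25 * k ^ 3 * (N * t.depth) + 39 * k ^ 3 * (N * t.depth) := by ring
  rw [coriolis, bind_cost, bind_cost, pure_cost]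
  omega

/-- Each body contributes six rows, and the summand `1` provides the lower bound `1 ≤ k`. -/
theorem sizeBound_of_le {n₀ d₀ : ℕ} (hn : ∀ i, t.bodies i ≤ n₀) (hd : ∀ i, t.dof i ≤ d₀) :
    SizeBound t (6 * n₀ + d₀ + 1) := by
  refine ⟨by omega, fun i => ?_, fun i => (hd i).trans (by omega)⟩
  have := hn i
  simp only [Fintype.card_prod, Fintype.card_sum, Fintype.card_fin]
  omega

end Alg

end Multibody

end

theorem mainTheorem10 {N : ℕ} (t : Multibody.ClusterTree N)
    {E : Type*} [NormedAddCommGroup E] [NormedSpace ℝ E] [FiniteDimensional ℝ E]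
    {Q : Type*} [TopologicalSpace Q] [ChartedSpace E Q] [IsManifold 𝓘(ℝ, E) ∞ Q]
    (S : Multibody.MultibodySystem t E Q) :
    (∀ (q : Q) (vbar : t.Speeds → ℝ),
      S.twists q vbar = (S.transform q * S.modes q) *ᵥ vbar ∧
      S.coriolisStar q vbar =
        (S.modes q)ᵀ * (S.transform q)ᵀ * S.factor q vbar * S.transform q * S.modes q
          + (S.modes q)ᵀ * (S.transform q)ᵀ * S.inertia * S.transform q * S.modesDot q vbar ∧
      (∀ cov : CovariantDerivative 𝓘(ℝ, E) E (fun q : Q => TangentSpace 𝓘(ℝ, E) q),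
        S.IsRiemannianConnection cov → ∀ i k : t.Speeds,
          S.coriolisStar q vbar i k =
            S.metric q (S.frame i q) (cov (S.frame k) q (S.velocity q vbar))) ∧
      (Multibody.Alg.coriolis (S.algInput q vbar)).val = S.coriolisStar q vbar) ∧
    ∃ K : ℕ → ℕ → ℕ, ∀ (N' : ℕ) (t' : Multibody.ClusterTree N') (inp : Multibody.AlgInput t')
      (n₀ d₀ : ℕ), (∀ i, t'.bodies i ≤ n₀) → (∀ i, t'.dof i ≤ d₀) →
        (Multibody.Alg.coriolis inp).cost ≤ K n₀ d₀ * (N' * t'.depth) := by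
  -- Completeness of the model space is what the lemmas on Lie brackets ask for.
  have : CompleteSpace E := FiniteDimensional.complete ℝ E
  exact ⟨fun q vbar => ⟨S.twists_eq q vbar, S.coriolisStar_eq q vbar,
      fun _ hcov i k => S.coriolisStar_eq_connection hcov q vbar i k, S.coriolis_val_eq q vbar⟩,
    fun n₀ d₀ => 64 * (6 * n₀ + d₀ + 1) ^ 3, fun _ _ _ _ _ hn hd =>
      Multibody.Alg.coriolis_cost_le (Multibody.Alg.sizeBound_of_le hn hd)⟩
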